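/- Consider a stochastic game with agents $1,\dots,n$ ($n\ge 1$), finite state space $\mathcal S$, finite nonempty action sets $\mathcal A_i$ ($\mathcal A=\prod_i\mathcal A_i$), transition law $P(\cdot\mid s,\boldsymbol a)$, rewards $r_i:\mathcal S\times\mathcal A\to[0,1]$, discount factor $\gamma\in(0,1)$ and initial distribution $\rho$. A (decentralized) policy is $\pi=(\pi_1,\dots,\pi_n)$ with $\pi_i:\mathcal S\to\Delta(\mathcal A_i)$ and $\pi(\boldsymbol a|s)=\prod_i\pi_i(a_i|s)$. For $f:\mathcal S\times\mathcal A\to\mathbb R$ put $V_f^\pi(s)=\mathbb E^\pi[\sum_{t\ge0}\gamma^t f(s^t,\boldsymbol a^t)\mid s^0=s]$, $Q_f^\pi(s,\boldsymbol a)=\mathbb E^\pi[\sum_{t\ge0}\gamma^t f(s^t,\boldsymbol a^t)\mid s^0=s,\boldsymbol a^0=\boldsymbol a]$, and write $V_i^\pi=V_{r_i}^\pi$, $V_i^\pi(\rho)=\mathbb E_{s\sim\rho}V_i^\pi(s)$, $A_i^\pi=Q_{r_i}^\pi-V_i^\pi$, $\bar A_i^\pi(s,a_i)=\sum_{a_{-i}}\pi_{-i}(a_{-i}|s)A_i^\pi(s,a_i,a_{-i})$,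 $d_\rho^\pi(s)=(1-\gamma)\sum_{t\ge0}\gamma^t\Pr^\pi(s^t=s\mid s^0\sim\rho)$ and $$\text{NE-gap}(\pi)=\max_{i,\ \pi_i':\mathcal S\to\Delta(\mathcal A_i)}\bigl[V_i^{\pi_i',\pi_{-i}}(\rho)-V_i^{\pi}(\rho)\bigr].$$ Assume that the game is a Markov potential game: there is $\phi:\mathcal S\times\mathcal A\to[0,\phi_{max}]$, $\phi_{max}>0$, with $V_i^{\pi_i',\pi_{-i}}(s)-V_i^{\pi}(s)=V_\phi^{\pi_i',\pi_{-i}}(s)-V_\phi^{\pi}(s)$ for all $i$, $s$, $\pi$, $\pi_i'$. Assume also that $\inf_\pi\min_s d_\rho^\pi(s)>0$, and put $M=\sup_\pi\max_s 1/d_\rho^\pi(s)$. Let $\pi^0$ be a softmax policy, $\pi_i^0(a_i|s)=\exp\theta_i(s,a_i)/\sum_b\exp\theta_i(s,b)$, and let $(\pi^k)_{k\ge0}$ be the iterates of independent natural policy gradient, $$\pi_i^{k+1}(a_i|s)\propto\pi_i^k(a_i|s)\exp\Bigl(\frac{\eta\,\bar A_i^{\pi^k}(s,a_i)}{1-\gamma}\Bigr),\qquad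 \eta=\frac{(1-\gamma)^2}{2\sqrt n\,\phi_{max}}.$$ Let $\mathcal A_{i}^{k}(s)=\arg\max_{a}\bar A_i^{\pi^k}(s,a)$, $c=\inf_{i,s,k}\sum_{a\in\mathcal A_i^k(s)}\pi_i^k(a|s)$, and $$\delta^k=\min_{i,s}\Bigl[\max_{a\in\mathcal A_i}\bar A_i^{\pi^k}(s,a)-\max_{a\in\mathcal A_i\setminus\mathcal A_i^k(s)}\bar A_i^{\pi^k}(s,a)\Bigr],$$ where pairs $(i,s)$ with $\mathcal A_i^k(s)=\mathcal A_i$ are omitted from the minimum (an empty minimum is $+\infty$). Assume that $\lim_{k\to\infty}\delta^k=\delta^*$ for some real $\delta^*>0$. Then $c>0$, and there is a finite $K'$ such that $\delta^k\ge\delta^*/2$ for all $k\ge K'$. For every such $K'$ and every $K\ge1$, $$\frac1K\sum_{k=0}^{K-1}\text{NE-gap}(\pi^k)\le\frac{2M\phi_{max}}{K(1-\gamma)}\Bigl(1+\frac{4\sqrt n\,\phi_{max}}{c\,\delta^*(1-\gamma)}+\frac{K'}{2M}\Bigr).$$ In particular the rate is $O(1/\epsilon)$: for every $\epsilon>0$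 the averaged NE-gap is at most $\epsilon$ for every integer $K\ge1$ with $K\ge\frac1\epsilon\cdot\frac{2M\phi_{max}}{1-\gamma}\bigl(1+\frac{4\sqrt n\,\phi_{max}}{c\,\delta^*(1-\gamma)}+\frac{K'}{2M}\bigr)$. -/

import Mathlib

open Filter Topology

/-- A discounted stochastic game with `n` agents, finite state space `S` and finite individual
action spaces `A i`: transition kernel `P`, rewards `r i` with values in `[0, 1]`, discount factor
`γ ∈ (0, 1)` and initial state distribution `ρ`. -/
structure StochasticGame (n : ℕ) (S : Type*) (A : Fin n → Type*) [Fintype S] where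
  /-- the transition law `P(· | s, a)` -/
  P : S → (∀ i, A i) → stdSimplex ℝ S
  /-- the reward `r_i(s, a)` of agent `i` -/
  r : Fin n → S → (∀ i, A i) → ℝ
  r_mem : ∀ i s a, r i s a ∈ Set.Icc (0 : ℝ) 1
  /-- the discount factor -/
  γ : ℝ
  γ_pos : 0 < γ
  γ_lt_one : γ < 1
  /-- the initial state distribution -/
  ρ : stdSimplex ℝ S

/-- A decentralized joint policy: each agent `i` has a local policy `S → Δ(A i)`. -/
abbrev JointPolicy {n : ℕ} (S : Type*) (A : Fin n → Type*) [∀ i, Fintype (A i)] : Type _ :=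
  ∀ i : Fin n, S → stdSimplex ℝ (A i)

namespace JointPolicy

variable {n : ℕ} {S : Type*} {A : Fin n → Type*} [∀ i, Fintype (A i)]

/-- `π(a | s) = ∏ i, π_i(a_i | s)`. -/
def prob (π : JointPolicy S A) (s : S) (a : ∀ i, A i) : ℝ :=
  ∏ i, (π i s).1 (a i)

/-- `π_{-i}(a_{-i} | s) = ∏_{j ≠ i} π_j(a_j | s)`; it does not depend on the coordinate `a i`. -/
def probOthers (π : JointPolicy S A) (i : Fin n) (s : S) (a : ∀ i, A i) : ℝ :=
  ∏ j ∈ Finset.univ.erase i, (π j s).1 (a j)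

/-- The joint policy `(π_i', π_{-i})`, where agent `i` deviates to `π_i'`. -/
def deviate (π : JointPolicy S A) (i : Fin n) (π' : S → stdSimplex ℝ (A i)) :
    JointPolicy S A :=
  Function.update π i π'

/-- The softmax policy `π_i(a_i | s) = exp θ_i(s, a_i) / ∑_b exp θ_i(s, b)`. -/
noncomputable def softmax [∀ i, Nonempty (A i)] (θ : ∀ i : Fin n, S → A i → ℝ) :
    JointPolicy S A :=
  fun i s => ⟨fun a => Real.exp (θ i s a) / ∑ b, Real.exp (θ i s b), by
    have hpos : 0 < ∑ b, Real.exp (θ i s b) :=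
      Finset.sum_pos (fun b _ => Real.exp_pos _) Finset.univ_nonempty
    refine ⟨fun a => (div_pos (Real.exp_pos _) hpos).le, ?_⟩
    rw [← Finset.sum_div, div_self hpos.ne']⟩

end JointPolicy

namespace StochasticGame

variable {n : ℕ} {S : Type*} {A : Fin n → Type*} [Fintype S] [DecidableEq S]
  [∀ i, Fintype (A i)] [∀ i, DecidableEq (A i)]

/-- The probability of `(s^t, a^t) = (s, a)` when `(s^0, a^0)` has law `ν`, the states evolve
by `P`, and the actions at times `t ≥ 1` are drawn from `π`. -/
noncomputable def law (G : StochasticGame n S A) (π : JointPolicy S A)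
    (ν : S → (∀ i, A i) → ℝ) : ℕ → S → (∀ i, A i) → ℝ
  | 0 => ν
  | t + 1 => fun s a =>
      (∑ s', ∑ a', G.law π ν t s' a' * (G.P s' a').1 s) * π.prob s a

/-- `𝔼^π [∑_t γ^t f(s^t, a^t) | (s^0, a^0) ∼ ν]`, the expectation of each summand being taken
with respect to the law of `(s^t, a^t)`. -/
noncomputable def discountedSum (G : StochasticGame n S A) (π : JointPolicy S A)
    (ν : S → (∀ i, A i) → ℝ) (f : S → (∀ i, A i) → ℝ) : ℝ :=
  ∑' t : ℕ, G.γ ^ t * ∑ s, ∑ a, G.law π ν t s a * f s a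

/-- The value function of the stage function `f`:
`𝔼^π [∑_t γ^t f(s^t, a^t) | s^0 = s]`, with `a^0 ∼ π(· | s)`. -/
noncomputable def value (G : StochasticGame n S A) (f : S → (∀ i, A i) → ℝ)
    (π : JointPolicy S A) (s : S) : ℝ :=
  G.discountedSum π (fun s' a => if s' = s then π.prob s a else 0) f

/-- The state-action value function of the stage function `f`:
`𝔼^π [∑_t γ^t f(s^t, a^t) | s^0 = s, a^0 = a]`. -/
noncomputable def qValue (G : StochasticGame n S A) (f : S → (∀ i, A i) → ℝ)
    (π : JointPolicy S A) (s : S) (a : ∀ i, A i) : ℝ :=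
  G.discountedSum π (fun s' a' => if s' = s ∧ a' = a then 1 else 0) f

/-- `V_i^π(ρ) = 𝔼_{s ∼ ρ} V_i^π(s)`. -/
noncomputable def valueInit (G : StochasticGame n S A) (i : Fin n) (π : JointPolicy S A) : ℝ :=
  ∑ s, G.ρ.1 s * G.value (G.r i) π s

/-- The discounted state visitation distribution
`d_ρ^π(s) = (1 - γ) 𝔼^π [∑_t γ^t 𝟙(s^t = s) | s^0 ∼ ρ]`. -/
noncomputable def visitation (G : StochasticGame n S A) (π : JointPolicy S A) (s : S) : ℝ :=
  (1 - G.γ) * G.discountedSum π (fun s' a => G.ρ.1 s' * π.prob s' a)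
    (fun s' _ => if s' = s then 1 else 0)

/-- The advantage function `A_i^π(s, a) = Q_i^π(s, a) - V_i^π(s)`. -/
noncomputable def advantage (G : StochasticGame n S A) (i : Fin n) (π : JointPolicy S A)
    (s : S) (a : ∀ i, A i) : ℝ :=
  G.qValue (G.r i) π s a - G.value (G.r i) π s

/-- The marginalized advantage function
`Ā_i^π(s, a_i) = ∑_{a_{-i}} π_{-i}(a_{-i} | s) A_i^π(s, a_i, a_{-i})`; the sum over `a_{-i}` is
written as the sum over the joint actions whose `i`-th coordinate is `a_i`. -/
noncomputable def margAdvantage (G : StochasticGame n S A) (i : Fin n) (π : JointPolicy S A)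
    (s : S) (ai : A i) : ℝ :=
  ∑ a : (∀ j, A j) with a i = ai, π.probOthers i s a * G.advantage i π s a

/-- `φ` is a potential function of the game: any unilateral change of policy changes the value
of the deviating agent and the total potential by the same amount, from every initial state. -/
def IsPotential (G : StochasticGame n S A) (φ : S → (∀ i, A i) → ℝ) : Prop :=
  ∀ (i : Fin n) (s : S) (π : JointPolicy S A) (π' : S → stdSimplex ℝ (A i)),
    G.value (G.r i) (π.deviate i π') s - G.value (G.r i) π s =
      G.value φ (π.deviate i π') s - G.value φ π s

/-- The NE-gap: the largest gain `V_i^{π_i', π_{-i}}(ρ) - V_i^π(ρ)` of any agent `i` by a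
unilateral deviation to any local policy `π_i'`. -/
noncomputable def neGap (G : StochasticGame n S A) (π : JointPolicy S A) : ℝ :=
  ⨆ x : (Σ i : Fin n, S → stdSimplex ℝ (A i)),
    (G.valueInit x.1 (π.deviate x.1 x.2) - G.valueInit x.1 π)

/-- The iterates of independent natural policy gradient with step size `η`:
`π_i^{k+1}(a_i | s) ∝ π_i^k(a_i | s) exp (η Ā_i^{π^k}(s, a_i) / (1 - γ))`. -/
def IsNPG (G : StochasticGame n S A) (η : ℝ) (π : ℕ → JointPolicy S A) : Prop :=
  ∀ (k : ℕ) (i : Fin n) (s : S) (a : A i),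
    (π (k + 1) i s).1 a =
      (π k i s).1 a * Real.exp (η * G.margAdvantage i (π k) s a / (1 - G.γ)) /
        ∑ b, (π k i s).1 b * Real.exp (η * G.margAdvantage i (π k) s b / (1 - G.γ))

open Classical in
/-- The best actions of agent `i` in state `s`: the maximizers of `Ā_i^π(s, ·)`. -/
noncomputable def bestActions (G : StochasticGame n S A) (π : JointPolicy S A) (i : Fin n)
    (s : S) : Finset (A i) :=
  {a | ∀ b, G.margAdvantage i π s b ≤ G.margAdvantage i π s a}

/-- The suboptimality gap `δ(π)`: the minimum over agents `i` and states `s` of the difference of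
`Ā_i^π(s, ·)` at a best action and at a best one among the remaining actions. Pairs `(i, s)` for
which all actions are best do not contribute (the infimum of the empty set is `⊤`). -/
noncomputable def subGap (G : StochasticGame n S A) (π : JointPolicy S A) : EReal :=
  ⨅ (i : Fin n) (s : S) (a ∈ G.bestActions π i s) (b ∉ G.bestActions π i s),
    ((G.margAdvantage i π s a - G.margAdvantage i π s b : ℝ) : EReal)

/-- `c = inf_{i, s, k} ∑_{a best at iteration k} π_i^k(a | s)`. -/
noncomputable def minBestMass (G : StochasticGame n S A) (π : ℕ → JointPolicy S A) : ℝ :=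
  ⨅ (k : ℕ) (i : Fin n) (s : S), ∑ a ∈ G.bestActions (π k) i s, (π k i s).1 a

/-- `M = sup_π max_s 1 / d_ρ^π(s)`. -/
noncomputable def mismatch (G : StochasticGame n S A) : ℝ :=
  ⨆ (π : JointPolicy S A) (s : S), 1 / G.visitation π s

end StochasticGame

/-!
Write `p = π^k`, `q = π^{k+1}`, let `κ = η / (1 - γ)` and `g_i(s) = ∑_b q_i(b | s) Ā_i^p(s, b)`.

*Increase of the potential.* The performance difference lemma (`performance_difference`) turns
`(1 - γ) (V_φ^q(ρ) - V_φ^p(ρ))` into the mean of `∑_a q(a | s) A_φ^p(s, a)` under the visitation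
distribution of `q`. To first order this sum is `∑ i, g_i(s)`: replacing one factor `p_i` by `q_i` gives the
marginalized advantage of the potential, which in a potential game is that of agent `i`
(`IsPotential.stageMargAdvantage_eq`). The remainder is bounded by `2 B √n ∑ i, J(p_i, q_i)`, with
`B` half the range of `Q_φ` and `J` the Jeffreys divergence (`abs_sum_prod_sub_le`); the factor is
`√n` and not `n` because `J` is additive over products and dominates the squared `ℓ¹` distance up to
a constant. For the multiplicative weights update `J(p_i, q_i) = κ g_i` (`jeffreys_mulWeights`), so
with the given step size the remainder is at most `½ ∑ i, g_i` (`sufficient_increase`).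

*Use of the gap.* If the best actions have mass at least `c` and beat the others by `δ / 2`, one
update realises a fixed fraction of the largest advantage: `max_b Ā_i(s, b) ≤ C g_i(s)` with
`C = 1 + 2 / (c κ δ)` (`le_mul_sum_mulWeights`). Together with `1 ≤ M d_ρ^q(s)` the NE-gap of `p`
is at most `2 M C` times the increase of the potential (`valueInit_deviate_sub_le`). This telescopes
for `k ≥ K'`; before `K'` the NE-gap is at most `φmax / (1 - γ)`.

*Positivity of `c`.* The increments of the bounded monotone potential tend to zero, hence so do the
divergences `J` and the moves of the policies (`tendsto_iterate_sub`). As the marginalized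
advantages are uniformly continuous in the policy, they too move by less than the gap allows, so
the sets of best actions are eventually constant; from then on their masses increase
(`IsNPG.minBestMass_pos`).
-/

/-! ### Product distributions and Jeffreys divergence -/

/-- The Jeffreys divergence `KL(q ‖ p) + KL(p ‖ q)` of two positive weight functions on a finite
type. -/
noncomputable def jeffreys {α : Type*} [Fintype α] (p q : α → ℝ) : ℝ :=
  ∑ a, (q a - p a) * (Real.log (q a) - Real.log (p a))

theorem sq_sub_div_add_le {x y : ℝ} (hx : 0 < x) (hy : 0 < y) :
    (y - x) ^ 2 / (y + x) ≤ (y - x) * (Real.log y - Real.log x) := by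
  wlog h : x ≤ y generalizing x y
  · have := this hy hx (le_of_not_ge h)
    calc (y - x) ^ 2 / (y + x) = (x - y) ^ 2 / (x + y) := by ring
      _ ≤ _ := this
      _ = _ := by ring
  have h1 : (y - x) / (y + x) ≤ Real.log y - Real.log x := by
    have h2 := Real.one_sub_inv_le_log_of_pos (div_pos hy hx)
    rw [Real.log_div hy.ne' hx.ne', inv_div] at h2
    refine le_trans ?_ h2
    rw [one_sub_div hy.ne']
    exact div_le_div_of_nonneg_left (by linarith) hy (by linarith)
  calc (y - x) ^ 2 / (y + x) = (y - x) * ((y - x) / (y + x)) := by ring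
    _ ≤ _ := mul_le_mul_of_nonneg_left h1 (by linarith)

theorem jeffreys_nonneg {α : Type*} [Fintype α] {p q : α → ℝ} (hp : ∀ a, 0 < p a)
    (hq : ∀ a, 0 < q a) : 0 ≤ jeffreys p q :=
  Finset.sum_nonneg fun a _ => le_trans
    (div_nonneg (sq_nonneg _) (add_pos (hq a) (hp a)).le) (sq_sub_div_add_le (hp a) (hq a))

/-- A Pinsker-type inequality, obtained from the Cauchy–Schwarz inequality with the weights
`q + p`. -/
theorem sq_sum_abs_sub_le_jeffreys {α : Type*} [Fintype α] {p q : α → ℝ} (hp : ∀ a, 0 < p a)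
    (hq : ∀ a, 0 < q a) (hp1 : ∑ a, p a = 1) (hq1 : ∑ a, q a = 1) :
    (∑ a, |q a - p a|) ^ 2 ≤ 2 * jeffreys p q := by
  have h := Finset.sq_sum_div_le_sum_sq_div Finset.univ (fun a => |q a - p a|)
    (g := fun a => q a + p a) (fun a _ => add_pos (hq a) (hp a))
  rw [Finset.sum_add_distrib, hp1, hq1] at h
  have h2 : ∑ a, |q a - p a| ^ 2 / (q a + p a) ≤ jeffreys p q :=
    Finset.sum_le_sum fun a _ => by rw [sq_abs]; exact sq_sub_div_add_le (hp a) (hq a)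
  linarith

section Product

variable {ι : Type*} [Fintype ι] [DecidableEq ι] {A : ι → Type*} [∀ i, Fintype (A i)]

theorem sum_prod_apply_eq_one {p : ∀ i, A i → ℝ} (hp : ∀ i, ∑ b, p i b = 1) :
    ∑ a : (∀ i, A i), ∏ i, p i (a i) = 1 := by
  rw [← Fintype.prod_sum]
  exact Finset.prod_eq_one fun i _ => hp i

theorem sum_prod_apply_mul {p : ∀ i, A i → ℝ} (hp : ∀ i, ∑ b, p i b = 1) (i : ι) (u : A i → ℝ) :
    ∑ a : (∀ i, A i), (∏ j, p j (a j)) * u (a i) = ∑ b, p i b * u b := by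
  have h : ∀ a : (∀ i, A i), (∏ j, p j (a j)) * u (a i) =
      ∏ j, Function.update p i (fun b => p i b * u b) j (a j) := by
    intro a
    rw [← Finset.mul_prod_erase _ _ (Finset.mem_univ i),
      ← Finset.mul_prod_erase _ (fun j => Function.update p i _ j (a j)) (Finset.mem_univ i),
      Function.update_self, mul_right_comm]
    congr 1
    refine Finset.prod_congr rfl fun j hj => ?_
    rw [Function.update_of_ne (Finset.ne_of_mem_erase hj)]
  simp_rw [h]
  rw [← Fintype.prod_sum, ← Finset.mul_prod_erase _ _ (Finset.mem_univ i), Function.update_self,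
    Finset.prod_eq_one (s := Finset.univ.erase i), mul_one]
  intro j hj
  rw [Function.update_of_ne (Finset.ne_of_mem_erase hj), hp]

theorem jeffreys_prod {p q : ∀ i, A i → ℝ} (hp : ∀ i b, 0 < p i b) (hq : ∀ i b, 0 < q i b)
    (hp1 : ∀ i, ∑ b, p i b = 1) (hq1 : ∀ i, ∑ b, q i b = 1) :
    jeffreys (fun a : (∀ i, A i) => ∏ i, p i (a i)) (fun a => ∏ i, q i (a i)) =
      ∑ i, jeffreys (p i) (q i) := by
  unfold jeffreys
  simp_rw [Real.log_prod (fun i _ => (hp i _).ne'), Real.log_prod (fun i _ => (hq i _).ne'),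
    ← Finset.sum_sub_distrib, Finset.mul_sum]
  rw [Finset.sum_comm]
  refine Finset.sum_congr rfl fun i _ => ?_
  simp_rw [sub_mul]
  rw [Finset.sum_sub_distrib, Finset.sum_sub_distrib]
  rw [sum_prod_apply_mul hp1 i (fun b => Real.log (q i b) - Real.log (p i b)),
    sum_prod_apply_mul hq1 i (fun b => Real.log (q i b) - Real.log (p i b))]

/-- The `ℓ¹` distance of two product distributions that differ only in the coordinates of `T`. -/
theorem sum_abs_prod_piecewise_sub_le {p q : ∀ i, A i → ℝ} (hp : ∀ i b, 0 < p i b)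
    (hq : ∀ i b, 0 < q i b) (hp1 : ∀ i, ∑ b, p i b = 1) (hq1 : ∀ i, ∑ b, q i b = 1)
    (T : Finset ι) :
    ∑ a : (∀ i, A i), |∏ i, T.piecewise q p i (a i) - ∏ i, p i (a i)| ≤
      √(2 * ∑ i, jeffreys (p i) (q i)) := by
  have hh : ∀ i b, 0 < T.piecewise q p i b := by
    intro i b
    by_cases h : i ∈ T
    · rw [T.piecewise_eq_of_mem _ _ h]; exact hq i b
    · rw [T.piecewise_eq_of_notMem _ _ h]; exact hp i b
  have hh1 : ∀ i, ∑ b, T.piecewise q p i b = 1 := by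
    intro i
    by_cases h : i ∈ T
    · rw [T.piecewise_eq_of_mem _ _ h]; exact hq1 i
    · rw [T.piecewise_eq_of_notMem _ _ h]; exact hp1 i
  apply Real.le_sqrt_of_sq_le
  refine (sq_sum_abs_sub_le_jeffreys (fun a => Finset.prod_pos fun i _ => hp i _)
    (fun a => Finset.prod_pos fun i _ => hh i _) (sum_prod_apply_eq_one hp1)
    (sum_prod_apply_eq_one hh1)).trans ?_
  rw [jeffreys_prod hp hh hp1 hh1]
  gcongr with i
  by_cases h : i ∈ T
  · rw [T.piecewise_eq_of_mem _ _ h]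
  · rw [T.piecewise_eq_of_notMem _ _ h]
    refine le_trans (le_of_eq ?_) (jeffreys_nonneg (hp i) (hq i))
    simp [jeffreys]

variable [∀ i, DecidableEq (A i)]

theorem sum_filter_apply_eq_of_update {W : (∀ i, A i) → ℝ} {i : ι}
    (hW : ∀ a b, W (Function.update a i b) = W a) (b b' : A i) :
    ∑ a : (∀ j, A j) with a i = b, W a = ∑ a : (∀ j, A j) with a i = b', W a := by
  refine Finset.sum_bij' (fun a _ => Function.update a i b') (fun a _ => Function.update a i b)
    ?_ ?_ ?_ ?_ ?_
  · simp
  · simp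
  · intro a ha
    have : a i = b := by simpa using ha
    simp [← this]
  · intro a ha
    have : a i = b' := by simpa using ha
    simp [← this]
  · intro a _
    rw [hW]

theorem sum_apply_mul_eq {W : (∀ i, A i) → ℝ} {i : ι} (u : A i → ℝ) :
    ∑ a : (∀ j, A j), u (a i) * W a = ∑ b, u b * ∑ a : (∀ j, A j) with a i = b, W a := by
  rw [← Finset.sum_fiberwise Finset.univ (fun a : (∀ j, A j) => a i)]
  refine Finset.sum_congr rfl fun b _ => ?_
  rw [Finset.mul_sum]
  refine Finset.sum_congr rfl fun a ha => ?_
  rw [(Finset.mem_filter.1 ha).2]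

theorem sum_apply_mul_eq_mul_sum {W : (∀ i, A i) → ℝ} {i : ι}
    (hW : ∀ a b, W (Function.update a i b) = W a) (u : A i → ℝ) {v : A i → ℝ}
    (hv : ∑ b, v b = 1) :
    ∑ a : (∀ j, A j), u (a i) * W a = (∑ b, u b) * ∑ a : (∀ j, A j), v (a i) * W a := by
  rcases isEmpty_or_nonempty (A i) with h | ⟨⟨b₀⟩⟩
  · simp at hv
  · rw [sum_apply_mul_eq, sum_apply_mul_eq]
    simp_rw [fun b => sum_filter_apply_eq_of_update hW b b₀, ← Finset.sum_mul, hv, one_mul]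

/-- First-order expansion of the expectation of `F` under a product distribution: the factors in
`T` are exchanged one after the other, and `D` bounds the `ℓ¹` distance from `p` of all the hybrid
distributions met on the way. -/
theorem abs_sum_prod_piecewise_sub_le {p q : ∀ i, A i → ℝ} (hp : ∀ i b, 0 ≤ p i b)
    (hp1 : ∀ i, ∑ b, p i b = 1) {D B : ℝ}
    (hD : ∀ T : Finset ι,
      ∑ a : (∀ i, A i), |∏ i, T.piecewise q p i (a i) - ∏ i, p i (a i)| ≤ D)
    {F : (∀ i, A i) → ℝ} (hF : ∀ a, |F a| ≤ B) (hB : 0 ≤ B) (T : Finset ι) :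
    |∑ a, (∏ i, T.piecewise q p i (a i) - ∏ i, p i (a i)) * F a -
      ∑ i ∈ T, ∑ a, (∏ j, Function.update p i (q i) j (a j) - ∏ j, p j (a j)) * F a| ≤
    B * ((∑ i ∈ T, ∑ b, |q i b - p i b|) * D) := by
  induction T using Finset.induction_on with
  | empty => simp
  | insert m T hm ih =>
    set h : ∀ i, A i → ℝ := T.piecewise q p with hh
    set R : (∀ i, A i) → ℝ := fun a => ∏ j ∈ Finset.univ.erase m, h j (a j) with hR
    set R₀ : (∀ i, A i) → ℝ := fun a => ∏ j ∈ Finset.univ.erase m, p j (a j) with hR₀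
    have e1 : ∀ a : (∀ i, A i), ∏ i, (insert m T).piecewise q p i (a i) = q m (a m) * R a := by
      intro a
      rw [← Finset.mul_prod_erase _ _ (Finset.mem_univ m), Finset.piecewise_insert_self]
      congr 1
      refine Finset.prod_congr rfl fun j hj => ?_
      simp only [hh, Finset.piecewise, Finset.mem_insert, Finset.ne_of_mem_erase hj, false_or]
    have e2 : ∀ a : (∀ i, A i), ∏ i, h i (a i) = p m (a m) * R a := by
      intro a
      rw [← Finset.mul_prod_erase _ _ (Finset.mem_univ m), hh,
        Finset.piecewise_eq_of_notMem _ _ _ hm]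
    have e3 : ∀ a : (∀ i, A i), ∏ i, p i (a i) = p m (a m) * R₀ a := fun a => by
      rw [← Finset.mul_prod_erase _ _ (Finset.mem_univ m)]
    have e4 : ∀ a : (∀ i, A i), ∏ j, Function.update p m (q m) j (a j) = q m (a m) * R₀ a := by
      intro a
      rw [← Finset.mul_prod_erase _ _ (Finset.mem_univ m), Function.update_self]
      congr 1
      refine Finset.prod_congr rfl fun j hj => ?_
      rw [Function.update_of_ne (Finset.ne_of_mem_erase hj)]
    have hW : ∀ a b, |R (Function.update a m b) - R₀ (Function.update a m b)| = |R a - R₀ a| := by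
      intro a b
      congr 2 <;>
      · refine Finset.prod_congr rfl fun j hj => ?_
        rw [Function.update_of_ne (Finset.ne_of_mem_erase hj)]
    have key : |∑ a : (∀ i, A i), (q m (a m) - p m (a m)) * (R a - R₀ a) * F a| ≤
        B * ((∑ b, |q m b - p m b|) * D) := by
      calc |∑ a : (∀ i, A i), (q m (a m) - p m (a m)) * (R a - R₀ a) * F a|
          ≤ ∑ a : (∀ i, A i), |(q m (a m) - p m (a m)) * (R a - R₀ a) * F a| :=
            Finset.abs_sum_le_sum_abs _ _
        _ ≤ ∑ a : (∀ i, A i), B * (|q m (a m) - p m (a m)| * |R a - R₀ a|) := by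
            refine Finset.sum_le_sum fun a _ => ?_
            rw [abs_mul, abs_mul, mul_comm]
            exact mul_le_mul_of_nonneg_right (hF a) (by positivity)
        _ = B * ((∑ b, |q m b - p m b|) * ∑ a : (∀ i, A i), p m (a m) * |R a - R₀ a|) := by
            rw [← Finset.mul_sum,
              sum_apply_mul_eq_mul_sum hW (fun b => |q m b - p m b|) (hp1 m)]
        _ ≤ _ := by
            have : ∑ a : (∀ i, A i), p m (a m) * |R a - R₀ a| ≤ D := by
              refine le_trans (le_of_eq ?_) (hD T)
              refine Finset.sum_congr rfl fun a _ => ?_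
              rw [e2, e3, ← mul_sub, abs_mul, abs_of_nonneg (hp m _)]
            gcongr
    rw [Finset.sum_insert hm, Finset.sum_insert hm]
    have split : ∑ a, (∏ i, (insert m T).piecewise q p i (a i) - ∏ i, p i (a i)) * F a -
        (∑ a, (∏ j, Function.update p m (q m) j (a j) - ∏ j, p j (a j)) * F a +
          ∑ i ∈ T, ∑ a, (∏ j, Function.update p i (q i) j (a j) - ∏ j, p j (a j)) * F a) =
        (∑ a, (∏ i, h i (a i) - ∏ i, p i (a i)) * F a -
          ∑ i ∈ T, ∑ a, (∏ j, Function.update p i (q i) j (a j) - ∏ j, p j (a j)) * F a) +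
        ∑ a : (∀ i, A i), (q m (a m) - p m (a m)) * (R a - R₀ a) * F a := by
      have : ∑ a, (∏ i, (insert m T).piecewise q p i (a i) - ∏ i, p i (a i)) * F a =
          ∑ a, (∏ i, h i (a i) - ∏ i, p i (a i)) * F a +
          ∑ a, (∏ j, Function.update p m (q m) j (a j) - ∏ j, p j (a j)) * F a +
          ∑ a : (∀ i, A i), (q m (a m) - p m (a m)) * (R a - R₀ a) * F a := by
        rw [← Finset.sum_add_distrib, ← Finset.sum_add_distrib]
        refine Finset.sum_congr rfl fun a _ => ?_
        rw [e1, e2, e3, e4]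
        ring
      rw [this]
      ring
    rw [split]
    refine (abs_add_le _ _).trans ((add_le_add ih key).trans (le_of_eq ?_))
    ring

/-- Replacing all factors of a product distribution changes the expectation of `F` by the sum of
the changes due to the single replacements, up to an error controlled by the Jeffreys
divergences. -/
theorem abs_sum_prod_sub_le {p q : ∀ i, A i → ℝ} (hp : ∀ i b, 0 < p i b)
    (hq : ∀ i b, 0 < q i b) (hp1 : ∀ i, ∑ b, p i b = 1) (hq1 : ∀ i, ∑ b, q i b = 1)
    {B : ℝ} {F : (∀ i, A i) → ℝ} (hF : ∀ a, |F a| ≤ B) (hB : 0 ≤ B) :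
    |∑ a, (∏ i, q i (a i) - ∏ i, p i (a i)) * F a -
      ∑ i, ∑ a, (∏ j, Function.update p i (q i) j (a j) - ∏ j, p j (a j)) * F a| ≤
    2 * B * √(Fintype.card ι : ℝ) * ∑ i, jeffreys (p i) (q i) := by
  have h := abs_sum_prod_piecewise_sub_le (fun i b => (hp i b).le) hp1
    (sum_abs_prod_piecewise_sub_le hp hq hp1 hq1) hF hB Finset.univ
  rw [Finset.piecewise_univ] at h
  refine h.trans ?_
  set J := ∑ i, jeffreys (p i) (q i)
  have hJ : 0 ≤ J := Finset.sum_nonneg fun i _ => jeffreys_nonneg (hp i) (hq i)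
  have h1 : ∑ i, ∑ b, |q i b - p i b| ≤ √(Fintype.card ι : ℝ) * √(2 * J) := by
    rw [← Real.sqrt_mul (Nat.cast_nonneg _)]
    apply Real.le_sqrt_of_sq_le
    refine (sq_sum_le_card_mul_sum_sq (s := Finset.univ)).trans ?_
    rw [Finset.card_univ]
    refine mul_le_mul_of_nonneg_left ?_ (Nat.cast_nonneg _)
    rw [Finset.mul_sum]
    refine Finset.sum_le_sum fun i _ => ?_
    exact sq_sum_abs_sub_le_jeffreys (hp i) (hq i) (hp1 i) (hq1 i)
  calc B * ((∑ i, ∑ b, |q i b - p i b|) * √(2 * J))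
      ≤ B * ((√(Fintype.card ι : ℝ) * √(2 * J)) * √(2 * J)) := by gcongr
    _ = 2 * B * √(Fintype.card ι : ℝ) * J := by
      rw [mul_assoc (√_), Real.mul_self_sqrt (by positivity)]
      ring

end Product

/-! ### Discounted sums and the performance difference -/

namespace JointPolicy

variable {n : ℕ} {S : Type*} {A : Fin n → Type*} [∀ i, Fintype (A i)]

theorem prob_nonneg (π : JointPolicy S A) (s : S) (a : ∀ i, A i) : 0 ≤ π.prob s a :=
  Finset.prod_nonneg fun i _ => (π i s).2.1 _

theorem sum_prob (π : JointPolicy S A) (s : S) : ∑ a, π.prob s a = 1 :=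
  sum_prod_apply_eq_one (p := fun i => (π i s).1) fun i => (π i s).2.2

theorem prob_eq_mul_probOthers (π : JointPolicy S A) (i : Fin n) (s : S) (a : ∀ i, A i) :
    π.prob s a = (π i s).1 (a i) * π.probOthers i s a :=
  (Finset.mul_prod_erase _ _ (Finset.mem_univ i)).symm

theorem probOthers_deviate (π : JointPolicy S A) (i : Fin n) (π' : S → stdSimplex ℝ (A i)) (s : S)
    (a : ∀ i, A i) : (π.deviate i π').probOthers i s a = π.probOthers i s a :=
  Finset.prod_congr rfl fun j hj => by
    rw [deviate, Function.update_of_ne (Finset.ne_of_mem_erase hj)]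

theorem prob_deviate (π : JointPolicy S A) (i : Fin n) (π' : S → stdSimplex ℝ (A i)) (s : S)
    (a : ∀ i, A i) : (π.deviate i π').prob s a = (π' s).1 (a i) * π.probOthers i s a := by
  rw [prob_eq_mul_probOthers _ i, probOthers_deviate, deviate, Function.update_self]

end JointPolicy

namespace StochasticGame

section Law

variable {n : ℕ} {S : Type*} {A : Fin n → Type*} [Fintype S] [∀ i, Fintype (A i)]
  (G : StochasticGame n S A) (π : JointPolicy S A)

theorem law_nonneg {ν : S → (∀ i, A i) → ℝ} (hν : ∀ s a, 0 ≤ ν s a) (t : ℕ) (s : S)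
    (a : ∀ i, A i) : 0 ≤ G.law π ν t s a := by
  induction t generalizing s a with
  | zero => exact hν s a
  | succ t ih =>
    refine mul_nonneg (Finset.sum_nonneg fun s' _ => Finset.sum_nonneg fun a' _ =>
      mul_nonneg (ih s' a') ((G.P s' a').2.1 s)) (π.prob_nonneg s a)

theorem sum_law_succ_mul (ν : S → (∀ i, A i) → ℝ) (t : ℕ) (V : S → ℝ) :
    ∑ s, ∑ a, G.law π ν (t + 1) s a * V s =
      ∑ s, ∑ a, G.law π ν t s a * ∑ s', (G.P s a).1 s' * V s' := by
  have h1 : ∀ s, ∑ a, G.law π ν (t + 1) s a * V s =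
      ∑ s', ∑ a', G.law π ν t s' a' * ((G.P s' a').1 s * V s) := by
    intro s
    have : ∀ a, G.law π ν (t + 1) s a * V s =
        ((∑ s', ∑ a', G.law π ν t s' a' * (G.P s' a').1 s) * V s) * π.prob s a := by
      intro a
      rw [law]; ring
    simp_rw [this]
    rw [← Finset.mul_sum, π.sum_prob, mul_one, Finset.sum_mul]
    simp_rw [Finset.sum_mul, mul_assoc]
  simp_rw [h1, Finset.mul_sum]
  rw [Finset.sum_comm]
  refine Finset.sum_congr rfl fun s _ => ?_
  rw [Finset.sum_comm]

theorem sum_law (ν : S → (∀ i, A i) → ℝ) (t : ℕ) :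
    ∑ s, ∑ a, G.law π ν t s a = ∑ s, ∑ a, ν s a := by
  induction t with
  | zero => rfl
  | succ t ih =>
    have h := G.sum_law_succ_mul π ν t (fun _ => 1)
    simp only [mul_one] at h
    rw [h, ← ih]
    refine Finset.sum_congr rfl fun s _ => Finset.sum_congr rfl fun a _ => ?_
    rw [(G.P s a).2.2, mul_one]

theorem law_le {ν : S → (∀ i, A i) → ℝ} (hν : ∀ s a, 0 ≤ ν s a) (t : ℕ) (s : S)
    (a : ∀ i, A i) : G.law π ν t s a ≤ ∑ s, ∑ a, ν s a := by
  rw [← G.sum_law π ν t]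
  refine le_trans ?_ (Finset.single_le_sum (f := fun s => ∑ a, G.law π ν t s a)
    (fun s _ => Finset.sum_nonneg fun a _ => G.law_nonneg π hν t s a) (Finset.mem_univ s))
  exact Finset.single_le_sum (f := fun a => G.law π ν t s a)
    (fun a _ => G.law_nonneg π hν t s a) (Finset.mem_univ a)

theorem abs_sum_law_mul_le {ν : S → (∀ i, A i) → ℝ} (hν : ∀ s a, 0 ≤ ν s a)
    (f : S → (∀ i, A i) → ℝ) (t : ℕ) :
    |∑ s, ∑ a, G.law π ν t s a * f s a| ≤ (∑ s, ∑ a, ν s a) * ∑ s, ∑ a, |f s a| := by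
  simp_rw [Finset.mul_sum]
  refine (Finset.abs_sum_le_sum_abs _ _).trans (Finset.sum_le_sum fun s _ =>
    (Finset.abs_sum_le_sum_abs _ _).trans (Finset.sum_le_sum fun a _ => ?_))
  rw [abs_mul, abs_of_nonneg (G.law_nonneg π hν t s a)]
  exact mul_le_mul_of_nonneg_right (G.law_le π hν t s a) (abs_nonneg _)

theorem summable_discounted {ν : S → (∀ i, A i) → ℝ} (hν : ∀ s a, 0 ≤ ν s a)
    (f : S → (∀ i, A i) → ℝ) :
    Summable fun t : ℕ => G.γ ^ t * ∑ s, ∑ a, G.law π ν t s a * f s a := by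
  refine Summable.of_norm_bounded (g := fun t : ℕ => G.γ ^ t *
    ((∑ s, ∑ a, ν s a) * ∑ s, ∑ a, |f s a|))
    ((summable_geometric_of_lt_one G.γ_pos.le G.γ_lt_one).mul_right _) fun t => ?_
  rw [Real.norm_eq_abs, abs_mul, abs_of_nonneg (pow_nonneg G.γ_pos.le t)]
  exact mul_le_mul_of_nonneg_left (G.abs_sum_law_mul_le π hν f t) (pow_nonneg G.γ_pos.le t)

theorem discountedSum_add {ν : S → (∀ i, A i) → ℝ} (hν : ∀ s a, 0 ≤ ν s a)
    (f g : S → (∀ i, A i) → ℝ) :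
    G.discountedSum π ν (fun s a => f s a + g s a) =
      G.discountedSum π ν f + G.discountedSum π ν g := by
  unfold discountedSum
  rw [← (G.summable_discounted π hν f).tsum_add (G.summable_discounted π hν g)]
  simp_rw [mul_add, Finset.sum_add_distrib, mul_add]

theorem discountedSum_const_mul (ν : S → (∀ i, A i) → ℝ) (c : ℝ) (f : S → (∀ i, A i) → ℝ) :
    G.discountedSum π ν (fun s a => c * f s a) = c * G.discountedSum π ν f := by
  unfold discountedSum
  rw [← tsum_mul_left]
  refine tsum_congr fun t => ?_
  simp_rw [Finset.mul_sum]
  refine Finset.sum_congr rfl fun s _ => Finset.sum_congr rfl fun a _ => ?_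
  ring

theorem discountedSum_nonneg {ν : S → (∀ i, A i) → ℝ} (hν : ∀ s a, 0 ≤ ν s a)
    {f : S → (∀ i, A i) → ℝ} (hf : ∀ s a, 0 ≤ f s a) : 0 ≤ G.discountedSum π ν f :=
  tsum_nonneg fun t => mul_nonneg (pow_nonneg G.γ_pos.le t) (Finset.sum_nonneg fun s _ =>
    Finset.sum_nonneg fun a _ => mul_nonneg (G.law_nonneg π hν t s a) (hf s a))

theorem discountedSum_le {ν : S → (∀ i, A i) → ℝ} (hν : ∀ s a, 0 ≤ ν s a)
    (hν1 : ∑ s, ∑ a, ν s a = 1) {f : S → (∀ i, A i) → ℝ} {C : ℝ} (hf : ∀ s a, f s a ≤ C) :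
    G.discountedSum π ν f ≤ C / (1 - G.γ) := by
  have hs := summable_geometric_of_lt_one G.γ_pos.le G.γ_lt_one
  rw [div_eq_mul_inv, mul_comm, ← tsum_geometric_of_lt_one G.γ_pos.le G.γ_lt_one,
    ← tsum_mul_right]
  refine (G.summable_discounted π hν f).tsum_le_tsum (fun t => ?_) (hs.mul_right C)
  refine mul_le_mul_of_nonneg_left ?_ (pow_nonneg G.γ_pos.le t)
  calc ∑ s, ∑ a, G.law π ν t s a * f s a ≤ ∑ s, ∑ a, G.law π ν t s a * C := by
        gcongr with s _ a
        · exact G.law_nonneg π hν t s a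
        · exact hf s a
    _ = C := by simp_rw [← Finset.sum_mul]; rw [G.sum_law, hν1, one_mul]

/-- Discounting a function of the state: the flow equation of the state process. -/
theorem discountedSum_state {ν : S → (∀ i, A i) → ℝ} (hν : ∀ s a, 0 ≤ ν s a) (V : S → ℝ) :
    G.discountedSum π ν (fun s _ => V s) = ∑ s, ∑ a, ν s a * V s +
      G.γ * G.discountedSum π ν (fun s a => ∑ s', (G.P s a).1 s' * V s') := by
  unfold discountedSum
  rw [(G.summable_discounted π hν (fun s _ => V s)).tsum_eq_zero_add, ← tsum_mul_left]
  congr 1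
  · rw [pow_zero, one_mul]; rfl
  · refine tsum_congr fun t => ?_
    rw [G.sum_law_succ_mul, pow_succ]
    ring

theorem law_succ_eq (ν : S → (∀ i, A i) → ℝ) (t : ℕ) :
    G.law π ν (t + 1) = G.law π (G.law π ν 1) t := by
  induction t with
  | zero => rfl
  | succ t ih =>
    funext s a
    rw [law, ih]
    rfl

theorem discountedSum_eq_add {ν : S → (∀ i, A i) → ℝ} (hν : ∀ s a, 0 ≤ ν s a)
    (f : S → (∀ i, A i) → ℝ) :
    G.discountedSum π ν f = ∑ s, ∑ a, ν s a * f s a +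
      G.γ * G.discountedSum π (G.law π ν 1) f := by
  unfold discountedSum
  rw [(G.summable_discounted π hν f).tsum_eq_zero_add, ← tsum_mul_left]
  congr 1
  · rw [pow_zero, one_mul]; rfl
  · refine tsum_congr fun t => ?_
    rw [law_succ_eq, pow_succ]
    ring

end Law

variable {n : ℕ} {S : Type*} {A : Fin n → Type*} [Fintype S] [DecidableEq S]
  [∀ i, Fintype (A i)] [∀ i, DecidableEq (A i)]
  (G : StochasticGame n S A) (π : JointPolicy S A)

theorem law_eq_sum (ν : S → (∀ i, A i) → ℝ) (t : ℕ) (s : S) (a : ∀ i, A i) :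
    G.law π ν t s a = ∑ s₀, ∑ a₀, ν s₀ a₀ *
      G.law π (fun s' a' => if s' = s₀ ∧ a' = a₀ then 1 else 0) t s a := by
  induction t generalizing s a with
  | zero =>
    simp only [law, mul_ite, mul_one, mul_zero, ite_and]
    simp
  | succ t ih =>
    have h : ∀ ν', G.law π ν' (t + 1) s a =
      ∑ x : S × (∀ i, A i), G.law π ν' t x.1 x.2 * (G.P x.1 x.2).1 s * π.prob s a := by
      intro ν'
      simp only [Fintype.sum_prod_type, law]
      rw [Finset.sum_mul]
      simp_rw [Finset.sum_mul]
    have h2 : ∀ g : S → (∀ i, A i) → ℝ, ∑ s₀, ∑ a₀, g s₀ a₀ = ∑ y : S × (∀ i, A i), g y.1 y.2 :=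
      fun g => by rw [Fintype.sum_prod_type]
    rw [h2, h]
    simp_rw [h, ih, h2, Finset.mul_sum, Finset.sum_mul]
    rw [Finset.sum_comm]
    simp_rw [mul_assoc]

/-- Discounted sums are linear in the initial law, so state-action values determine them. -/
theorem discountedSum_eq_sum_qValue (ν : S → (∀ i, A i) → ℝ) (f : S → (∀ i, A i) → ℝ) :
    G.discountedSum π ν f = ∑ s, ∑ a, ν s a * G.qValue f π s a := by
  have hδ : ∀ (s : S) (a : ∀ i, A i) (s' : S) (a' : ∀ i, A i),
      (0 : ℝ) ≤ if s' = s ∧ a' = a then 1 else 0 := by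
    intro s a s' a'
    split_ifs <;> norm_num
  have hs : ∀ s₀ a₀, Summable fun t : ℕ => ν s₀ a₀ * (G.γ ^ t * ∑ s, ∑ a,
      G.law π (fun s' a' => if s' = s₀ ∧ a' = a₀ then 1 else 0) t s a * f s a) :=
    fun s₀ a₀ => (G.summable_discounted π (hδ s₀ a₀) f).mul_left _
  unfold qValue discountedSum
  simp_rw [← tsum_mul_left]
  rw [Finset.sum_congr rfl fun s₀ _ => (Summable.tsum_finsetSum fun a₀ _ => hs s₀ a₀).symm,
    ← Summable.tsum_finsetSum fun s₀ _ => summable_sum fun a₀ _ => hs s₀ a₀]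
  refine tsum_congr fun t => ?_
  have h2 : ∀ g : S → (∀ i, A i) → ℝ, ∑ s₀, ∑ a₀, g s₀ a₀ = ∑ y : S × (∀ i, A i), g y.1 y.2 :=
    fun g => by rw [Fintype.sum_prod_type]
  simp_rw [fun s a => G.law_eq_sum π ν t s a, h2, Finset.mul_sum, Finset.sum_mul, Finset.mul_sum]
  rw [Finset.sum_comm]
  refine Finset.sum_congr rfl fun y _ => Finset.sum_congr rfl fun x _ => ?_
  ring

theorem value_eq_sum (f : S → (∀ i, A i) → ℝ) (s : S) :
    G.value f π s = ∑ a, π.prob s a * G.qValue f π s a := by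
  rw [value, discountedSum_eq_sum_qValue, Finset.sum_eq_single s]
  · simp
  · intro s' _ h
    simp [h]
  · simp

theorem qValue_eq (f : S → (∀ i, A i) → ℝ) (s : S) (a : ∀ i, A i) :
    G.qValue f π s a = f s a + G.γ * ∑ s', (G.P s a).1 s' * G.value f π s' := by
  have hδ : ∀ (s' : S) (a' : ∀ i, A i), (0 : ℝ) ≤ if s' = s ∧ a' = a then 1 else 0 := by
    intro s' a'
    split_ifs <;> norm_num
  rw [qValue, discountedSum_eq_add _ _ hδ, discountedSum_eq_sum_qValue]
  have h1 : ∀ g : S → (∀ i, A i) → ℝ,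
      ∑ s', ∑ a', (if s' = s ∧ a' = a then 1 else 0) * g s' a' = g s a := by
    intro g
    rw [Finset.sum_eq_single s (fun s' _ h => by simp [h]) (by simp)]
    simp
  rw [h1]
  congr 2
  refine Finset.sum_congr rfl fun s' _ => ?_
  rw [value_eq_sum, Finset.mul_sum]
  refine Finset.sum_congr rfl fun a' _ => ?_
  simp only [law]
  rw [h1 (fun s₀ a₀ => (G.P s₀ a₀).1 s')]
  ring

end StochasticGame

namespace StochasticGame

section InitialDistribution

variable {n : ℕ} {S : Type*} {A : Fin n → Type*} [Fintype S] [∀ i, Fintype (A i)]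
  (G : StochasticGame n S A) (π : JointPolicy S A)

theorem discountedSum_finset_sum {ν : S → (∀ i, A i) → ℝ} (hν : ∀ s a, 0 ≤ ν s a) {κ : Type*}
    (T : Finset κ) (f : κ → S → (∀ i, A i) → ℝ) :
    G.discountedSum π ν (fun s a => ∑ k ∈ T, f k s a) = ∑ k ∈ T, G.discountedSum π ν (f k) := by
  classical
  induction T using Finset.induction_on with
  | empty => simp [discountedSum]
  | insert k T hk ih =>
    simp_rw [Finset.sum_insert hk]
    rw [G.discountedSum_add π hν, ih]

theorem init_nonneg (s : S) (a : ∀ i, A i) : 0 ≤ G.ρ.1 s * π.prob s a :=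
  mul_nonneg (G.ρ.2.1 s) (π.prob_nonneg s a)

theorem sum_init : ∑ s, ∑ a, G.ρ.1 s * π.prob s a = 1 := by
  simp_rw [← Finset.mul_sum, π.sum_prob, mul_one]
  exact G.ρ.2.2

end InitialDistribution

variable {n : ℕ} {S : Type*} {A : Fin n → Type*} [Fintype S] [DecidableEq S]
  [∀ i, Fintype (A i)] [∀ i, DecidableEq (A i)]
  (G : StochasticGame n S A) (π : JointPolicy S A)

/-- The expected value `𝔼_{s ∼ ρ} V_f^π(s)` of the stage function `f`. -/
noncomputable def stageValueInit (f : S → (∀ i, A i) → ℝ) : ℝ :=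
  ∑ s, G.ρ.1 s * G.value f π s

/-- The advantage function `Q_f^π - V_f^π` of the stage function `f`. -/
noncomputable def stageAdvantage (f : S → (∀ i, A i) → ℝ) (s : S) (a : ∀ i, A i) : ℝ :=
  G.qValue f π s a - G.value f π s

/-- The advantage function of the stage function `f`, averaged over the actions of all agents but
`i`. -/
noncomputable def stageMargAdvantage (f : S → (∀ i, A i) → ℝ) (i : Fin n) (s : S) (b : A i) : ℝ :=
  ∑ a : (∀ j, A j) with a i = b, π.probOthers i s a * G.stageAdvantage π f s a

theorem sum_prob_mul_stageAdvantage (f : S → (∀ i, A i) → ℝ) (s : S) :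
    ∑ a, π.prob s a * G.stageAdvantage π f s a = 0 := by
  simp_rw [stageAdvantage, mul_sub]
  rw [Finset.sum_sub_distrib, ← value_eq_sum, ← Finset.sum_mul, π.sum_prob, one_mul, sub_self]

theorem sum_prob_deviate_mul_stageAdvantage (f : S → (∀ i, A i) → ℝ) (i : Fin n)
    (π' : S → stdSimplex ℝ (A i)) (s : S) :
    ∑ a, (π.deviate i π').prob s a * G.stageAdvantage π f s a =
      ∑ b, (π' s).1 b * G.stageMargAdvantage π f i s b := by
  simp_rw [π.prob_deviate, mul_assoc]
  exact sum_apply_mul_eq (W := fun a => π.probOthers i s a * G.stageAdvantage π f s a) (π' s).1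

theorem sum_mul_stageMargAdvantage (f : S → (∀ i, A i) → ℝ) (i : Fin n) (s : S) :
    ∑ b, (π i s).1 b * G.stageMargAdvantage π f i s b = 0 := by
  rw [← sum_prob_deviate_mul_stageAdvantage, JointPolicy.deviate, Function.update_eq_self,
    sum_prob_mul_stageAdvantage]

theorem discountedSum_init (f : S → (∀ i, A i) → ℝ) :
    G.discountedSum π (fun s a => G.ρ.1 s * π.prob s a) f = G.stageValueInit π f := by
  rw [discountedSum_eq_sum_qValue, stageValueInit]
  refine Finset.sum_congr rfl fun s _ => ?_
  rw [value_eq_sum, Finset.mul_sum]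
  simp_rw [mul_assoc]

omit [∀ i, DecidableEq (A i)] in
theorem visitation_nonneg (s : S) : 0 ≤ G.visitation π s :=
  mul_nonneg (sub_nonneg.2 G.γ_lt_one.le) (G.discountedSum_nonneg π (G.init_nonneg π)
    fun s' _ => by split_ifs <;> norm_num)

omit [∀ i, DecidableEq (A i)] in
theorem visitation_le_one (s : S) : G.visitation π s ≤ 1 := by
  have h := G.discountedSum_le π (G.init_nonneg π) (G.sum_init π)
    (f := fun s' _ => if s' = s then 1 else 0) (C := 1) fun s' _ => by split_ifs <;> norm_num
  rw [le_div_iff₀ (sub_pos.2 G.γ_lt_one), mul_comm] at h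
  exact h

omit [∀ i, DecidableEq (A i)] in
/-- The discounted sum from `ρ` is the mean under the visitation distribution. -/
theorem discountedSum_init_eq_sum_visitation (f : S → (∀ i, A i) → ℝ) :
    (1 - G.γ) * G.discountedSum π (fun s a => G.ρ.1 s * π.prob s a) f =
      ∑ s, G.visitation π s * ∑ a, π.prob s a * f s a := by
  set ν : S → (∀ i, A i) → ℝ := fun s a => G.ρ.1 s * π.prob s a
  have hlaw : ∀ t, ∃ m : S → ℝ, ∀ s a, G.law π ν t s a = m s * π.prob s a := by
    intro t
    cases t with
    | zero => exact ⟨G.ρ.1, fun s a => rfl⟩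
    | succ t => exact ⟨_, fun s a => rfl⟩
  set h : S → ℝ := fun s => ∑ a, π.prob s a * f s a with hh
  have h1 : G.discountedSum π ν f = G.discountedSum π ν (fun s _ => h s) := by
    unfold discountedSum
    refine tsum_congr fun t => ?_
    obtain ⟨m, hm⟩ := hlaw t
    congr 1
    refine Finset.sum_congr rfl fun s _ => ?_
    simp_rw [hm, mul_assoc]
    rw [← Finset.mul_sum, ← Finset.mul_sum, ← Finset.sum_mul, π.sum_prob, one_mul]
  have h2 : (fun (s : S) (_ : ∀ i, A i) => h s) =
      fun s _ => ∑ s', h s' * (if s = s' then 1 else 0) := by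
    funext s a
    simp
  rw [h1, h2, G.discountedSum_finset_sum π (G.init_nonneg π), Finset.mul_sum]
  refine Finset.sum_congr rfl fun s _ => ?_
  rw [G.discountedSum_const_mul π ν (h s) (fun s' _ => if s' = s then 1 else 0), visitation]
  ring

theorem discountedSum_stageAdvantage (π' : JointPolicy S A) {ν : S → (∀ i, A i) → ℝ}
    (hν : ∀ s a, 0 ≤ ν s a) (f : S → (∀ i, A i) → ℝ) :
    G.discountedSum π' ν (G.stageAdvantage π f) =
      G.discountedSum π' ν f - ∑ s, ∑ a, ν s a * G.value f π s := by
  have h1 := G.discountedSum_add π' hν (G.stageAdvantage π f) (fun s _ => G.value f π s)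
  have h2 := G.discountedSum_add π' hν f
    (fun s a => G.γ * ∑ s', (G.P s a).1 s' * G.value f π s')
  have h3 : (fun s a => G.stageAdvantage π f s a + G.value f π s) =
      fun s a => f s a + G.γ * ∑ s', (G.P s a).1 s' * G.value f π s' := by
    funext s a
    rw [stageAdvantage, sub_add_cancel, qValue_eq]
  rw [h3, h2, G.discountedSum_const_mul, G.discountedSum_state π' hν] at h1
  linarith

/-- The performance difference lemma. -/
theorem performance_difference (π' : JointPolicy S A) (f : S → (∀ i, A i) → ℝ) :
    (1 - G.γ) * (G.stageValueInit π' f - G.stageValueInit π f) =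
      ∑ s, G.visitation π' s * ∑ a, π'.prob s a * G.stageAdvantage π f s a := by
  rw [← discountedSum_init_eq_sum_visitation, discountedSum_stageAdvantage _ _ _ (G.init_nonneg π'),
    discountedSum_init]
  congr 2
  refine Finset.sum_congr rfl fun s _ => ?_
  rw [← Finset.sum_mul, ← Finset.mul_sum, π'.sum_prob, mul_one]

/-! ### Bounds for values -/

theorem qValue_mem_Icc {f : S → (∀ i, A i) → ℝ} {C : ℝ} (hf : ∀ s a, 0 ≤ f s a ∧ f s a ≤ C)
    (s : S) (a : ∀ i, A i) : G.qValue f π s a ∈ Set.Icc 0 (C / (1 - G.γ)) := by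
  have hδ : ∀ (s' : S) (a' : ∀ i, A i), (0 : ℝ) ≤ if s' = s ∧ a' = a then 1 else 0 := by
    intro s' a'
    split_ifs <;> norm_num
  refine ⟨G.discountedSum_nonneg π hδ fun s a => (hf s a).1,
    G.discountedSum_le π hδ ?_ fun s a => (hf s a).2⟩
  rw [Finset.sum_eq_single s (fun s' _ h => by simp [h]) (by simp)]
  simp

theorem stageValueInit_mem_Icc {f : S → (∀ i, A i) → ℝ} {C : ℝ}
    (hf : ∀ s a, 0 ≤ f s a ∧ f s a ≤ C) :
    G.stageValueInit π f ∈ Set.Icc 0 (C / (1 - G.γ)) := by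
  rw [← discountedSum_init]
  exact ⟨G.discountedSum_nonneg π (G.init_nonneg π) fun s a => (hf s a).1,
    G.discountedSum_le π (G.init_nonneg π) (G.sum_init π) fun s a => (hf s a).2⟩

/-! ### Potential games -/

variable {G}

omit [∀ i, DecidableEq (A i)] in
theorem IsPotential.stageValueInit_deviate_sub {φ : S → (∀ i, A i) → ℝ} (hφ : G.IsPotential φ)
    (i : Fin n) (π' : S → stdSimplex ℝ (A i)) :
    G.stageValueInit (π.deviate i π') (G.r i) - G.stageValueInit π (G.r i) =
      G.stageValueInit (π.deviate i π') φ - G.stageValueInit π φ := by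
  unfold stageValueInit
  simp_rw [← Finset.sum_sub_distrib, ← mul_sub, hφ i _ π π']

/-- In a potential game the marginalized advantages of an agent are those of the potential: compare
the performance differences for a deviation that is pure in one state and trivial elsewhere. -/
theorem IsPotential.stageMargAdvantage_eq {φ : S → (∀ i, A i) → ℝ} (hφ : G.IsPotential φ)
    (hvis : ∀ (π : JointPolicy S A) s, 0 < G.visitation π s) (i : Fin n) (s : S) (b : A i) :
    G.stageMargAdvantage π φ i s b = G.margAdvantage i π s b := by
  change _ = G.stageMargAdvantage π (G.r i) i s b
  set π' : S → stdSimplex ℝ (A i) :=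
    Function.update (π i) s ⟨Pi.single b 1, single_mem_stdSimplex ℝ b⟩ with hπ'
  have key : ∀ f : S → (∀ i, A i) → ℝ,
      (1 - G.γ) * (G.stageValueInit (π.deviate i π') f - G.stageValueInit π f) =
        G.visitation (π.deviate i π') s * G.stageMargAdvantage π f i s b := by
    intro f
    rw [performance_difference, Finset.sum_eq_single s]
    · rw [sum_prob_deviate_mul_stageAdvantage, hπ', Function.update_self]
      congr 1
      simp [Pi.single_apply]
    · intro s' _ hs'
      rw [sum_prob_deviate_mul_stageAdvantage, hπ', Function.update_of_ne hs',
        sum_mul_stageMargAdvantage, mul_zero]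
    · simp
  have h := key φ
  rw [← hφ.stageValueInit_deviate_sub π i π', key (G.r i)] at h
  exact (mul_left_cancel₀ (hvis _ s).ne' h).symm

end StochasticGame

/-! ### The multiplicative weights update -/

section MulWeights

variable {α : Type*} [Fintype α]

/-- The multiplicative weights update of the distribution `p` with the gains `u` and the learning
rate `κ`. -/
noncomputable def mulWeights (κ : ℝ) (u p : α → ℝ) (a : α) : ℝ :=
  p a * Real.exp (κ * u a) / ∑ b, p b * Real.exp (κ * u b)

variable {κ : ℝ} {u p : α → ℝ}

theorem sum_mul_exp_pos (hp : ∀ a, 0 < p a) (hp1 : ∑ a, p a = 1) :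
    0 < ∑ b, p b * Real.exp (κ * u b) := by
  refine Finset.sum_pos (fun b _ => mul_pos (hp b) (Real.exp_pos _)) ?_
  rw [Finset.nonempty_iff_ne_empty]
  intro h
  rw [h] at hp1
  simp at hp1

theorem mulWeights_pos (hp : ∀ a, 0 < p a) (hp1 : ∑ a, p a = 1) (a : α) :
    0 < mulWeights κ u p a :=
  div_pos (mul_pos (hp a) (Real.exp_pos _)) (sum_mul_exp_pos hp hp1)

theorem sum_mulWeights (hp : ∀ a, 0 < p a) (hp1 : ∑ a, p a = 1) :
    ∑ a, mulWeights κ u p a = 1 := by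
  unfold mulWeights
  rw [← Finset.sum_div, div_self (sum_mul_exp_pos hp hp1).ne']

theorem jeffreys_mulWeights (hp : ∀ a, 0 < p a) (hp1 : ∑ a, p a = 1) (hu : ∑ a, p a * u a = 0) :
    jeffreys p (mulWeights κ u p) = κ * ∑ a, mulWeights κ u p a * u a := by
  have hZ := sum_mul_exp_pos (κ := κ) (u := u) hp hp1
  have h : ∀ a, Real.log (mulWeights κ u p a) - Real.log (p a) =
      κ * u a - Real.log (∑ b, p b * Real.exp (κ * u b)) := by
    intro a
    rw [mulWeights, Real.log_div (mul_pos (hp a) (Real.exp_pos _)).ne' hZ.ne',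
      Real.log_mul (hp a).ne' (Real.exp_pos _).ne', Real.log_exp]
    ring
  unfold jeffreys
  simp_rw [h, mul_sub, sub_mul]
  rw [Finset.sum_sub_distrib, Finset.sum_sub_distrib, Finset.sum_sub_distrib, ← Finset.sum_mul,
    ← Finset.sum_mul, sum_mulWeights hp hp1, hp1, Finset.mul_sum]
  have h2 : ∑ a, p a * (κ * u a) = κ * ∑ a, p a * u a := by
    rw [Finset.mul_sum]
    exact Finset.sum_congr rfl fun a _ => by ring
  rw [h2, hu, mul_zero, sub_zero, sub_self, sub_zero]
  exact Finset.sum_congr rfl fun a _ => by ring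

theorem le_mulWeights_of_forall_le (hκ : 0 ≤ κ) (hp : ∀ a, 0 < p a) (hp1 : ∑ a, p a = 1) {a : α}
    (ha : ∀ b, u b ≤ u a) : p a ≤ mulWeights κ u p a := by
  rw [mulWeights, le_div_iff₀ (sum_mul_exp_pos hp hp1)]
  refine mul_le_mul_of_nonneg_left ?_ (hp a).le
  calc ∑ b, p b * Real.exp (κ * u b) ≤ ∑ b, p b * Real.exp (κ * u a) := by
        gcongr with b
        · exact (hp b).le
        · exact ha b
    _ = Real.exp (κ * u a) := by rw [← Finset.sum_mul, hp1, one_mul]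

/-- If the maximum `m` of the centred gains `u` exceeds all gains outside `T` by `g` and `T`
has mass at least `c`, then one update realises a fixed fraction of `m`.

The deficits `d = m - u` have mean `m` under `p`, and the claim is that under the updated
distribution their mean is at most `τ = m / (1 + c κ g)`. Weights decrease in `d`, so
comparing the weight of each action outside `T` with the weight `v` at deficit `max τ g` bounds the
weighted sum of `d - τ`. -/
theorem le_mul_sum_mulWeights (hκ : 0 < κ) (hp : ∀ a, 0 < p a) (hp1 : ∑ a, p a = 1)
    (hu : ∑ a, p a * u a = 0) {m g c : ℝ} {T : Finset α} (hT : ∀ a ∈ T, u a = m)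
    (hm : ∀ a, u a ≤ m) (hg : 0 < g) (hgap : ∀ a ∉ T, u a + g ≤ m) (hc : 0 < c)
    (hcT : c ≤ ∑ a ∈ T, p a) :
    m ≤ (1 + 1 / (c * (κ * g))) * ∑ a, mulWeights κ u p a * u a := by
  classical
  have hm0 : 0 ≤ m := by
    have : ∑ a, p a * u a ≤ ∑ a, p a * m :=
      Finset.sum_le_sum fun a _ => mul_le_mul_of_nonneg_left (hm a) (hp a).le
    rwa [hu, ← Finset.sum_mul, hp1, one_mul] at this
  have hy : 0 < κ * g := mul_pos hκ hg
  set y := κ * g with hydef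
  have hx : 0 < c * y := mul_pos hc hy
  set τ := m / (1 + c * y) with hτdef
  have hτ0 : 0 ≤ τ := div_nonneg hm0 (by linarith)
  have hmτ : m = (1 + c * y) * τ := by rw [hτdef]; field_simp
  set v := Real.exp (-(max (κ * τ) y)) with hv
  set P := ∑ a ∈ T, p a with hP
  have hPc : P + ∑ a ∈ Tᶜ, p a = 1 := by rw [hP, Finset.sum_add_sum_compl, hp1]
  have hPd : ∑ a ∈ Tᶜ, p a * (m - u a) = m := by
    have h1 : ∑ a ∈ T, p a * (m - u a) + ∑ a ∈ Tᶜ, p a * (m - u a) = m := by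
      rw [Finset.sum_add_sum_compl]
      simp_rw [mul_sub]
      rw [Finset.sum_sub_distrib, ← Finset.sum_mul, hp1, hu]
      ring
    rw [Finset.sum_eq_zero fun a ha => by rw [hT a ha, sub_self, mul_zero], zero_add] at h1
    exact h1
  have hvy : v * (1 + y) ≤ 1 := by
    have h1 : v ≤ Real.exp (-y) := Real.exp_le_exp.2 (neg_le_neg (le_max_right _ _))
    have h2 : 1 + y ≤ Real.exp y := by linarith [Real.add_one_le_exp y]
    calc v * (1 + y) ≤ Real.exp (-y) * Real.exp y :=
          mul_le_mul h1 h2 (by linarith) (Real.exp_pos _).le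
      _ = 1 := by rw [← Real.exp_add, neg_add_cancel, Real.exp_zero]
  have hpt : ∀ a ∈ Tᶜ, p a * Real.exp (-(κ * (m - u a))) * (m - u a - τ) ≤
      v * (p a * (m - u a) - p a * τ) := by
    intro a ha
    have hd : g ≤ m - u a := by linarith [hgap a (Finset.mem_compl.1 ha)]
    have : Real.exp (-(κ * (m - u a))) * (m - u a - τ) ≤ v * (m - u a - τ) := by
      rcases le_total τ (m - u a) with h | h
      · refine mul_le_mul_of_nonneg_right (Real.exp_le_exp.2 (neg_le_neg (max_le ?_ ?_)))
          (by linarith)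
        · exact mul_le_mul_of_nonneg_left h hκ.le
        · exact mul_le_mul_of_nonneg_left hd hκ.le
      · refine mul_le_mul_of_nonpos_right (Real.exp_le_exp.2 (neg_le_neg ?_)) (by linarith)
        exact le_max_of_le_left (mul_le_mul_of_nonneg_left h hκ.le)
    calc _ = p a * (Real.exp (-(κ * (m - u a))) * (m - u a - τ)) := by ring
      _ ≤ p a * (v * (m - u a - τ)) := mul_le_mul_of_nonneg_left this (hp a).le
      _ = _ := by ring
  have hsum : ∑ a, p a * Real.exp (-(κ * (m - u a))) * (m - u a - τ) ≤ 0 := by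
    rw [← Finset.sum_add_sum_compl T]
    have h1 : ∑ a ∈ T, p a * Real.exp (-(κ * (m - u a))) * (m - u a - τ) = -(P * τ) := by
      rw [hP, Finset.sum_mul, ← Finset.sum_neg_distrib]
      refine Finset.sum_congr rfl fun a ha => ?_
      rw [hT a ha]
      simp
    have h2 := Finset.sum_le_sum hpt
    rw [← Finset.mul_sum, Finset.sum_sub_distrib, hPd, ← Finset.sum_mul,
      show ∑ a ∈ Tᶜ, p a = 1 - P by linarith] at h2
    have h3 : m - (1 - P) * τ ≤ P * τ * (1 + y) := by
      have : c * y * τ ≤ P * y * τ := by gcongr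
      rw [hmτ]
      linarith
    have h4 : v * (m - (1 - P) * τ) ≤ P * τ := by
      calc v * (m - (1 - P) * τ) ≤ v * (P * τ * (1 + y)) :=
            mul_le_mul_of_nonneg_left h3 (Real.exp_pos _).le
        _ = P * τ * (v * (1 + y)) := by ring
        _ ≤ P * τ * 1 := mul_le_mul_of_nonneg_left hvy
            (mul_nonneg (hc.le.trans hcT) hτ0)
        _ = P * τ := mul_one _
    linarith
  have hZ := sum_mul_exp_pos (κ := κ) (u := u) hp hp1
  have hmean : m - τ ≤ ∑ a, mulWeights κ u p a * u a := by
    have h1 : ∑ a, mulWeights κ u p a * (m - u a - τ) ≤ 0 := by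
      have h2 : ∀ a, mulWeights κ u p a * (m - u a - τ) =
          Real.exp (κ * m) / (∑ b, p b * Real.exp (κ * u b)) *
            (p a * Real.exp (-(κ * (m - u a))) * (m - u a - τ)) := by
        intro a
        rw [mulWeights, show κ * u a = κ * m + -(κ * (m - u a)) by ring, Real.exp_add]
        ring
      simp_rw [h2]
      rw [← Finset.mul_sum]
      exact mul_nonpos_of_nonneg_of_nonpos (div_pos (Real.exp_pos _) hZ).le hsum
    have h3 : ∑ a, mulWeights κ u p a * (m - u a - τ) =
        (m - τ) * ∑ a, mulWeights κ u p a - ∑ a, mulWeights κ u p a * u a := by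
      rw [Finset.mul_sum, ← Finset.sum_sub_distrib]
      exact Finset.sum_congr rfl fun a _ => by ring
    rw [h3, sum_mulWeights hp hp1] at h1
    linarith
  calc m = (1 + 1 / (c * y)) * (m - τ) := by
        rw [hmτ]; field_simp; ring
    _ ≤ _ := mul_le_mul_of_nonneg_left hmean (by positivity)

end MulWeights

/-! ### One step of independent natural policy gradient -/

namespace StochasticGame

variable {n : ℕ} {S : Type*} {A : Fin n → Type*} [Fintype S] [DecidableEq S]
  [∀ i, Fintype (A i)] [∀ i, DecidableEq (A i)]
  {G : StochasticGame n S A} {p q : JointPolicy S A}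

omit [Fintype S] [DecidableEq S] [∀ i, DecidableEq (A i)] in
theorem prod_update_eq_prob_deviate (p q : JointPolicy S A) (i : Fin n) (s : S)
    (a : ∀ i, A i) :
    ∏ j, Function.update (fun j => (p j s).1) i (q i s).1 j (a j) =
      (p.deviate i (q i)).prob s a := by
  refine Finset.prod_congr rfl fun j _ => ?_
  rw [JointPolicy.deviate]
  by_cases h : j = i
  · subst h
    simp
  · rw [Function.update_of_ne h, Function.update_of_ne h]

/-- In one state, the joint update gains in the potential at least half of the gains of the single
agents. -/
theorem half_sum_le_sum_prob_mul_stageAdvantage (hn : 0 < n) {φ : S → (∀ i, A i) → ℝ} {φmax : ℝ}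
    (hφmax : 0 < φmax) (hφ_mem : ∀ s a, 0 ≤ φ s a ∧ φ s a ≤ φmax) (s : S)
    (hp : ∀ i b, 0 < (p i s).1 b) (hq : ∀ i b, 0 < (q i s).1 b)
    (hJ : ∀ i, jeffreys (p i s).1 (q i s).1 =
      (1 - G.γ) / (2 * √(n : ℝ) * φmax) * ∑ b, (q i s).1 b * G.stageMargAdvantage p φ i s b) :
    1 / 2 * ∑ i, ∑ b, (q i s).1 b * G.stageMargAdvantage p φ i s b ≤
      ∑ a, q.prob s a * G.stageAdvantage p φ s a := by
  have hγ : 0 < 1 - G.γ := sub_pos.2 G.γ_lt_one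
  set B := φmax / (1 - G.γ) / 2 with hB
  have hB0 : 0 ≤ B := by positivity
  -- centring `Q` at the midpoint of its range gains a factor two
  set F : (∀ i, A i) → ℝ := fun a => G.qValue φ p s a - B with hF
  have hFB : ∀ a, |F a| ≤ B := by
    intro a
    obtain ⟨h0, h1⟩ := G.qValue_mem_Icc p hφ_mem s a
    rw [abs_le]
    constructor <;> simp only [hF] <;> linarith
  have hdiff : ∀ r : JointPolicy S A, ∑ a, (r.prob s a - p.prob s a) * F a =
      ∑ a, r.prob s a * G.stageAdvantage p φ s a := by
    intro r
    have h1 : ∀ a, (r.prob s a - p.prob s a) * F a = r.prob s a * G.stageAdvantage p φ s a -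
        p.prob s a * G.stageAdvantage p φ s a +
        (r.prob s a - p.prob s a) * (G.value φ p s - B) := by
      intro a
      simp only [hF, stageAdvantage]
      ring
    simp_rw [h1]
    rw [Finset.sum_add_distrib, Finset.sum_sub_distrib, sum_prob_mul_stageAdvantage,
      ← Finset.sum_mul, Finset.sum_sub_distrib, r.sum_prob, p.sum_prob]
    ring
  have h := abs_sum_prod_sub_le (p := fun i => (p i s).1) (q := fun i => (q i s).1) hp hq
    (fun i => (p i s).2.2) (fun i => (q i s).2.2) hFB hB0
  simp_rw [prod_update_eq_prob_deviate p q] at h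
  change |∑ a, (q.prob s a - p.prob s a) * F a -
    ∑ i, ∑ a, ((p.deviate i (q i)).prob s a - p.prob s a) * F a| ≤ _ at h
  simp_rw [hdiff, sum_prob_deviate_mul_stageAdvantage, hJ] at h
  rw [← Finset.mul_sum, Fintype.card_fin] at h
  set Γ := ∑ i, ∑ b, (q i s).1 b * G.stageMargAdvantage p φ i s b
  have hn' : 0 < √(n : ℝ) := Real.sqrt_pos.2 (Nat.cast_pos.2 hn)
  have h2 : 2 * B * √(n : ℝ) * ((1 - G.γ) / (2 * √(n : ℝ) * φmax) * Γ) = 1 / 2 * Γ := by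
    rw [hB]
    field_simp
  rw [h2] at h
  linarith [(abs_le.1 h).1]

/-- Sufficient increase of the potential. -/
theorem sufficient_increase (hn : 0 < n) {φ : S → (∀ i, A i) → ℝ} {φmax : ℝ}
    (hφmax : 0 < φmax) (hφ_mem : ∀ s a, 0 ≤ φ s a ∧ φ s a ≤ φmax)
    (hp : ∀ i s b, 0 < (p i s).1 b) (hq : ∀ i s b, 0 < (q i s).1 b)
    (hJ : ∀ i s, jeffreys (p i s).1 (q i s).1 =
      (1 - G.γ) / (2 * √(n : ℝ) * φmax) * ∑ b, (q i s).1 b * G.stageMargAdvantage p φ i s b) :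
    1 / 2 * ∑ s, G.visitation q s * ∑ i, ∑ b, (q i s).1 b * G.stageMargAdvantage p φ i s b ≤
      (1 - G.γ) * (G.stageValueInit q φ - G.stageValueInit p φ) := by
  rw [performance_difference, Finset.mul_sum]
  refine Finset.sum_le_sum fun s _ => ?_
  rw [mul_left_comm]
  exact mul_le_mul_of_nonneg_left (half_sum_le_sum_prob_mul_stageAdvantage hn hφmax hφ_mem s
    (fun i => hp i s) (fun i => hq i s) fun i => hJ i s) (G.visitation_nonneg q s)

/-- Any deviation gains at most the increase of the potential in the next step, up to a factor, if
one update realises the fraction `1 / C` of all marginalized advantages. -/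
theorem valueInit_deviate_sub_le (hn : 0 < n) {φ : S → (∀ i, A i) → ℝ} {φmax : ℝ}
    (hφmax : 0 < φmax) (hφ_mem : ∀ s a, 0 ≤ φ s a ∧ φ s a ≤ φmax)
    (hφ : G.IsPotential φ) (hvis : ∀ (π : JointPolicy S A) s, 0 < G.visitation π s)
    (hp : ∀ i s b, 0 < (p i s).1 b) (hq : ∀ i s b, 0 < (q i s).1 b)
    (hJ : ∀ i s, jeffreys (p i s).1 (q i s).1 =
      (1 - G.γ) / (2 * √(n : ℝ) * φmax) * ∑ b, (q i s).1 b * G.margAdvantage i p s b)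
    {M C : ℝ} (hM : ∀ s, 1 ≤ M * G.visitation q s) (hM0 : 0 ≤ M) (hC : 0 ≤ C)
    (hgain : ∀ i s b, G.margAdvantage i p s b ≤
      C * ∑ b', (q i s).1 b' * G.margAdvantage i p s b')
    (i : Fin n) (π' : S → stdSimplex ℝ (A i)) :
    G.valueInit i (p.deviate i π') - G.valueInit i p ≤
      2 * M * C * (G.stageValueInit q φ - G.stageValueInit p φ) := by
  have hγ : 0 < 1 - G.γ := sub_pos.2 G.γ_lt_one
  have hn' : 0 < √(n : ℝ) := Real.sqrt_pos.2 (Nat.cast_pos.2 hn)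
  set g : Fin n → S → ℝ := fun i s => ∑ b, (q i s).1 b * G.margAdvantage i p s b with hg
  have hg0 : ∀ i s, 0 ≤ g i s := by
    intro i s
    have h1 := jeffreys_nonneg (hp i s) (hq i s)
    rw [hJ] at h1
    exact nonneg_of_mul_nonneg_right h1 (by positivity)
  have hinc := sufficient_increase (G := G) hn hφmax hφ_mem hp hq (fun i s => by
    simp_rw [hφ.stageMargAdvantage_eq p hvis]; exact hJ i s)
  simp_rw [hφ.stageMargAdvantage_eq p hvis] at hinc
  have hperf := G.performance_difference p (p.deviate i π') (G.r i)
  simp_rw [sum_prob_deviate_mul_stageAdvantage] at hperf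
  have hdev : (1 - G.γ) * (G.valueInit i (p.deviate i π') - G.valueInit i p) ≤
      ∑ s, M * C * (G.visitation q s * ∑ i, g i s) := by
    refine le_trans (le_of_eq hperf) (Finset.sum_le_sum fun s _ => ?_)
    have h1 : ∑ b, (π' s).1 b * G.margAdvantage i p s b ≤ C * g i s := by
      calc _ ≤ ∑ b, (π' s).1 b * (C * g i s) := Finset.sum_le_sum fun b _ =>
            mul_le_mul_of_nonneg_left (hgain i s b) ((π' s).2.1 b)
        _ = C * g i s := by rw [← Finset.sum_mul, (π' s).2.2, one_mul]
    have h2 : G.visitation (p.deviate i π') s ≤ M * G.visitation q s :=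
      (G.visitation_le_one _ s).trans (hM s)
    have h3 : g i s ≤ ∑ i, g i s :=
      Finset.single_le_sum (f := fun i => g i s) (fun i _ => hg0 i s) (Finset.mem_univ i)
    calc _ ≤ G.visitation (p.deviate i π') s * (C * g i s) :=
          mul_le_mul_of_nonneg_left h1 (G.visitation_nonneg _ s)
      _ ≤ (M * G.visitation q s) * (C * g i s) :=
          mul_le_mul_of_nonneg_right h2 (mul_nonneg hC (hg0 i s))
      _ ≤ (M * G.visitation q s) * (C * ∑ i, g i s) :=
          mul_le_mul_of_nonneg_left (mul_le_mul_of_nonneg_left h3 hC)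
            (mul_nonneg hM0 (G.visitation_nonneg _ s))
      _ = _ := by ring
  rw [← Finset.mul_sum] at hdev
  have h4 := mul_le_mul_of_nonneg_left hinc (mul_nonneg zero_le_two (mul_nonneg hM0 hC))
  refine le_of_mul_le_mul_left ?_ hγ
  linarith

end StochasticGame

/-! ### Continuity in the policy -/

namespace StochasticGame

section Continuity

variable {n : ℕ} {S : Type*} {A : Fin n → Type*} [Fintype S] [∀ i, Fintype (A i)]

omit [Fintype S] in
theorem continuous_apply_prob (i : Fin n) (s : S) (b : A i) :
    Continuous fun π : JointPolicy S A => (π i s).1 b :=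
  (continuous_apply b).comp (continuous_subtype_val.comp
    ((continuous_apply s).comp (continuous_apply i)))

omit [Fintype S] in
theorem continuous_prob (s : S) (a : ∀ i, A i) :
    Continuous fun π : JointPolicy S A => π.prob s a :=
  continuous_finsetProd _ fun i _ => continuous_apply_prob i s (a i)

omit [Fintype S] in
theorem continuous_probOthers (i : Fin n) (s : S) (a : ∀ i, A i) :
    Continuous fun π : JointPolicy S A => π.probOthers i s a :=
  continuous_finsetProd _ fun i _ => continuous_apply_prob i s (a i)

theorem continuous_law (G : StochasticGame n S A) (ν : S → (∀ i, A i) → ℝ) (t : ℕ) (s : S)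
    (a : ∀ i, A i) : Continuous fun π : JointPolicy S A => G.law π ν t s a := by
  induction t generalizing s a with
  | zero => exact continuous_const
  | succ t ih =>
    exact (continuous_finsetSum _ fun s' _ => continuous_finsetSum _ fun a' _ =>
      (ih s' a').mul continuous_const).mul (continuous_prob s a)

theorem continuous_discountedSum (G : StochasticGame n S A) {ν : S → (∀ i, A i) → ℝ}
    (hν : ∀ s a, 0 ≤ ν s a) (f : S → (∀ i, A i) → ℝ) :
    Continuous fun π : JointPolicy S A => G.discountedSum π ν f := by
  refine continuous_tsum (u := fun t : ℕ => G.γ ^ t *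
    ((∑ s, ∑ a, ν s a) * ∑ s, ∑ a, |f s a|)) (fun t => ?_)
    ((summable_geometric_of_lt_one G.γ_pos.le G.γ_lt_one).mul_right _) fun t π => ?_
  · exact continuous_const.mul (continuous_finsetSum _ fun s _ => continuous_finsetSum _ fun a _ =>
      (G.continuous_law ν t s a).mul continuous_const)
  · rw [Real.norm_eq_abs, abs_mul, abs_of_nonneg (pow_nonneg G.γ_pos.le t)]
    exact mul_le_mul_of_nonneg_left (G.abs_sum_law_mul_le π hν f t) (pow_nonneg G.γ_pos.le t)

end Continuity

variable {n : ℕ} {S : Type*} {A : Fin n → Type*} [Fintype S] [DecidableEq S]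
  [∀ i, Fintype (A i)] [∀ i, DecidableEq (A i)]

theorem continuous_qValue (G : StochasticGame n S A) (f : S → (∀ i, A i) → ℝ) (s : S)
    (a : ∀ i, A i) : Continuous fun π : JointPolicy S A => G.qValue f π s a :=
  G.continuous_discountedSum (fun s' a' => by split_ifs <;> norm_num) f

theorem continuous_margAdvantage (G : StochasticGame n S A) (i : Fin n) (s : S) (b : A i) :
    Continuous fun π : JointPolicy S A => G.margAdvantage i π s b := by
  have hV : Continuous fun π : JointPolicy S A => G.value (G.r i) π s := by
    simp_rw [value_eq_sum]
    exact continuous_finsetSum _ fun a _ => (continuous_prob s a).mul (G.continuous_qValue _ s a)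
  exact continuous_finsetSum _ fun a _ => (continuous_probOthers i s a).mul
    ((G.continuous_qValue _ s a).sub hV)

theorem tendsto_margAdvantage_sub (G : StochasticGame n S A) {π : ℕ → JointPolicy S A}
    (hπ : ∀ i s b, Tendsto (fun k => (π (k + 1) i s).1 b - (π k i s).1 b) atTop (𝓝 0))
    (i : Fin n) (s : S) (b : A i) :
    Tendsto (fun k => G.margAdvantage i (π (k + 1)) s b - G.margAdvantage i (π k) s b) atTop
      (𝓝 0) := by
  have hcpt : ∀ i, CompactSpace (stdSimplex ℝ (A i)) := fun i =>
    isCompact_iff_compactSpace.1 (isCompact_stdSimplex ℝ (A i))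
  have huc := CompactSpace.uniformContinuous_of_continuous (G.continuous_margAdvantage i s b)
  rw [Metric.uniformContinuous_iff] at huc
  rw [Metric.tendsto_atTop']
  intro ε hε
  obtain ⟨d, hd, h⟩ := huc ε hε
  have hev : ∀ᶠ k in atTop, ∀ i s b, |(π (k + 1) i s).1 b - (π k i s).1 b| < d := by
    rw [eventually_all]; intro i
    rw [eventually_all]; intro s
    rw [eventually_all]; intro b
    have := (hπ i s b).eventually (Metric.ball_mem_nhds 0 hd)
    simpa [Real.dist_eq] using this
  obtain ⟨N, hN⟩ := eventually_atTop.1 hev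
  refine ⟨N, fun k hk => ?_⟩
  have hdist : dist (π (k + 1)) (π k) < d := by
    rw [dist_pi_lt_iff hd]; intro i
    rw [dist_pi_lt_iff hd]; intro s
    rw [Subtype.dist_eq, dist_pi_lt_iff hd]; intro b
    exact hN k hk.le i s b
  simpa [Real.dist_eq] using h hdist

/-! ### Best actions and the suboptimality gap -/

theorem mem_bestActions {G : StochasticGame n S A} {π : JointPolicy S A} {i : Fin n} {s : S}
    {a : A i} : a ∈ G.bestActions π i s ↔
      ∀ b, G.margAdvantage i π s b ≤ G.margAdvantage i π s a := by
  simp [bestActions]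

theorem bestActions_nonempty [∀ i, Nonempty (A i)] (G : StochasticGame n S A)
    (π : JointPolicy S A) (i : Fin n) (s : S) : (G.bestActions π i s).Nonempty := by
  obtain ⟨a, ha⟩ := Finite.exists_max (G.margAdvantage i π s)
  exact ⟨a, mem_bestActions.2 ha⟩

theorem add_le_of_le_subGap {G : StochasticGame n S A} {π : JointPolicy S A} {g : ℝ}
    (h : (g : EReal) ≤ G.subGap π) {i : Fin n} {s : S} {a b : A i} (ha : a ∈ G.bestActions π i s)
    (hb : b ∉ G.bestActions π i s) : G.margAdvantage i π s b + g ≤ G.margAdvantage i π s a := by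
  simp only [subGap, le_iInf_iff] at h
  have := EReal.coe_le_coe_iff.1 (h i s a ha b hb)
  linarith

/-- If the gaps stay above `g`, the best actions cannot change while the marginalized advantages
move by less than `g / 2`. -/
theorem bestActions_eq_of_close [∀ i, Nonempty (A i)] {G : StochasticGame n S A}
    {p q : JointPolicy S A} {g : ℝ}
    (hp : (g : EReal) ≤ G.subGap p) (hq : (g : EReal) ≤ G.subGap q) (i : Fin n) (s : S)
    (h : ∀ b, |G.margAdvantage i q s b - G.margAdvantage i p s b| < g / 2) :
    G.bestActions q i s = G.bestActions p i s := by
  have key : ∀ p q : JointPolicy S A, (g : EReal) ≤ G.subGap p → (G.bestActions p i s).Nonempty →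
      (∀ b, |G.margAdvantage i q s b - G.margAdvantage i p s b| < g / 2) →
      G.bestActions q i s ⊆ G.bestActions p i s := by
    rintro p q hp ⟨a, ha⟩ h b hb
    by_contra hb'
    have h1 := add_le_of_le_subGap hp ha hb'
    have h2 := mem_bestActions.1 hb a
    have h3 := abs_lt.1 (h a)
    have h4 := abs_lt.1 (h b)
    linarith
  exact (key p q hp (G.bestActions_nonempty p i s) h).antisymm
    (key q p hq (G.bestActions_nonempty q i s) fun b => by rw [abs_sub_comm]; exact h b)

/-! ### The iterates of natural policy gradient -/

variable {G : StochasticGame n S A} {π : ℕ → JointPolicy S A} {η : ℝ}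

theorem IsNPG.eq_mulWeights (h : G.IsNPG η π) (k : ℕ) (i : Fin n) (s : S) :
    (π (k + 1) i s).1 =
      mulWeights (η / (1 - G.γ)) (G.margAdvantage i (π k) s) (π k i s).1 := by
  funext a
  rw [mulWeights]
  simp_rw [h k i s a, div_mul_eq_mul_div]

theorem IsNPG.pos (h : G.IsNPG η π) (h0 : ∀ i s a, 0 < (π 0 i s).1 a) (k : ℕ) (i : Fin n) (s : S)
    (a : A i) : 0 < (π k i s).1 a := by
  induction k generalizing i s a with
  | zero => exact h0 i s a
  | succ k ih =>
    rw [h.eq_mulWeights]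
    exact mulWeights_pos (ih i s) (π k i s).2.2 a

theorem IsNPG.jeffreys_eq (h : G.IsNPG η π) (h0 : ∀ i s a, 0 < (π 0 i s).1 a) (k : ℕ) (i : Fin n)
    (s : S) : jeffreys (π k i s).1 (π (k + 1) i s).1 =
      η / (1 - G.γ) * ∑ b, (π (k + 1) i s).1 b * G.margAdvantage i (π k) s b := by
  rw [h.eq_mulWeights]
  exact jeffreys_mulWeights (h.pos h0 k i s) (π k i s).2.2
    (G.sum_mul_stageMargAdvantage (π k) (G.r i) i s)

end StochasticGame

namespace StochasticGame

theorem nonempty_state {n : ℕ} {S : Type*} {A : Fin n → Type*} [Fintype S]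
    (G : StochasticGame n S A) : Nonempty S := by
  by_contra h
  rw [not_nonempty_iff] at h
  simpa using G.ρ.2.2

variable {n : ℕ} {S : Type*} {A : Fin n → Type*} [Fintype S] [DecidableEq S]
  [∀ i, Fintype (A i)] [∀ i, DecidableEq (A i)]
  {G : StochasticGame n S A} {π : ℕ → JointPolicy S A} {φ : S → (∀ i, A i) → ℝ} {φmax : ℝ}

omit [∀ i, DecidableEq (A i)] in
theorem iInf_visitation_le (G : StochasticGame n S A) (p : JointPolicy S A) (s : S) :
    ⨅ (p : JointPolicy S A) (s : S), G.visitation p s ≤ G.visitation p s := by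
  have h1 : BddBelow (Set.range fun p : JointPolicy S A => ⨅ s, G.visitation p s) :=
    ⟨0, by rintro _ ⟨p, rfl⟩; exact Real.iInf_nonneg fun s => G.visitation_nonneg p s⟩
  exact (ciInf_le h1 p).trans (ciInf_le (Set.finite_range _).bddBelow s)

omit [∀ i, DecidableEq (A i)] in
theorem one_div_visitation_le_mismatch
    (hexp : 0 < ⨅ (p : JointPolicy S A) (s : S), G.visitation p s) (p : JointPolicy S A) (s : S) :
    1 / G.visitation p s ≤ G.mismatch := by
  have := G.nonempty_state
  have h1 : BddAbove (Set.range fun p : JointPolicy S A => ⨆ s, 1 / G.visitation p s) := by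
    refine ⟨1 / ⨅ (p : JointPolicy S A) (s : S), G.visitation p s, ?_⟩
    rintro _ ⟨p, rfl⟩
    exact ciSup_le fun s => one_div_le_one_div_of_le hexp (G.iInf_visitation_le p s)
  exact (le_ciSup (f := fun s => 1 / G.visitation p s) (Set.finite_range _).bddAbove s).trans
    (le_ciSup h1 p)

theorem minBestMass_le (k : ℕ) (i : Fin n) (s : S) :
    G.minBestMass π ≤ ∑ a ∈ G.bestActions (π k) i s, (π k i s).1 a := by
  have h0 : ∀ k i s, 0 ≤ ∑ a ∈ G.bestActions (π k) i s, (π k i s).1 a := fun k i s =>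
    Finset.sum_nonneg fun a _ => (π k i s).2.1 a
  have h1 : BddBelow (Set.range fun k => ⨅ (i : Fin n) (s : S),
      ∑ a ∈ G.bestActions (π k) i s, (π k i s).1 a) :=
    ⟨0, by rintro _ ⟨k, rfl⟩; exact Real.iInf_nonneg fun i => Real.iInf_nonneg fun s => h0 k i s⟩
  exact (ciInf_le h1 k).trans ((ciInf_le (Set.finite_range _).bddBelow i).trans
    (ciInf_le (Set.finite_range _).bddBelow s))

/-! ### Asymptotics of the iterates -/

/-- The policies move less and less, because the increments of the bounded monotone sequence of
potentials dominate the Jeffreys divergences between consecutive iterates. -/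
theorem tendsto_iterate_sub (hn : 0 < n) (hφ : G.IsPotential φ) (hφmax : 0 < φmax)
    (hφ_mem : ∀ s a, 0 ≤ φ s a ∧ φ s a ≤ φmax)
    (hexp : 0 < ⨅ (p : JointPolicy S A) (s : S), G.visitation p s)
    (hpos : ∀ k i s a, 0 < (π k i s).1 a)
    (hJ : ∀ k i s, jeffreys (π k i s).1 (π (k + 1) i s).1 = (1 - G.γ) / (2 * √(n : ℝ) * φmax) *
      ∑ b, (π (k + 1) i s).1 b * G.margAdvantage i (π k) s b)
    (i : Fin n) (s : S) (b : A i) :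
    Tendsto (fun k => (π (k + 1) i s).1 b - (π k i s).1 b) atTop (𝓝 0) := by
  have hγ : 0 < 1 - G.γ := sub_pos.2 G.γ_lt_one
  have hn' : 0 < √(n : ℝ) := Real.sqrt_pos.2 (Nat.cast_pos.2 hn)
  set v := ⨅ (p : JointPolicy S A) (s : S), G.visitation p s
  have hvis : ∀ (p : JointPolicy S A) s, v ≤ G.visitation p s := G.iInf_visitation_le
  have hvis0 : ∀ (p : JointPolicy S A) s, 0 < G.visitation p s := fun p s =>
    hexp.trans_le (hvis p s)
  set κ := (1 - G.γ) / (2 * √(n : ℝ) * φmax) with hκ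
  have hκ0 : 0 < κ := by positivity
  set V : ℕ → ℝ := fun k => G.stageValueInit (π k) φ with hV
  set J : ℕ → Fin n → S → ℝ := fun k i s => jeffreys (π k i s).1 (π (k + 1) i s).1 with hJdef
  have hJ0 : ∀ k i s, 0 ≤ J k i s := fun k i s => jeffreys_nonneg (hpos k i s) (hpos (k + 1) i s)
  have hinc : ∀ k i s, J k i s ≤ 2 * κ / v * (1 - G.γ) * (V (k + 1) - V k) := by
    intro k i s
    have h := sufficient_increase (G := G) hn hφmax hφ_mem (hpos k) (hpos (k + 1)) (fun i s => by
      simp_rw [hφ.stageMargAdvantage_eq (π k) hvis0]; exact hJ k i s)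
    simp_rw [hφ.stageMargAdvantage_eq (π k) hvis0] at h
    have hg : ∀ i s, ∑ b, (π (k + 1) i s).1 b * G.margAdvantage i (π k) s b = J k i s / κ := by
      intro i s
      rw [eq_div_iff hκ0.ne', mul_comm]
      exact (hJ k i s).symm
    simp_rw [hg] at h
    have h1 : v * (J k i s / κ) ≤ ∑ s, G.visitation (π (k + 1)) s * ∑ i, J k i s / κ := by
      have h2 : J k i s / κ ≤ ∑ i, J k i s / κ :=
        Finset.single_le_sum (f := fun i => J k i s / κ)
          (fun i _ => div_nonneg (hJ0 k i s) hκ0.le) (Finset.mem_univ i)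
      have h3 : ∀ s, 0 ≤ ∑ i, J k i s / κ := fun s =>
        Finset.sum_nonneg fun i _ => div_nonneg (hJ0 k i s) hκ0.le
      refine le_trans ?_ (Finset.single_le_sum
        (f := fun s => G.visitation (π (k + 1)) s * ∑ i, J k i s / κ)
        (fun s _ => mul_nonneg (hvis0 _ s).le (h3 s)) (Finset.mem_univ s))
      exact mul_le_mul (hvis _ s) h2 (div_nonneg (hJ0 k i s) hκ0.le) (hvis0 _ s).le
    have h4 : v * (J k i s / κ) ≤ 2 * ((1 - G.γ) * (V (k + 1) - V k)) := by linarith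
    calc J k i s = κ / v * (v * (J k i s / κ)) := by field_simp
      _ ≤ κ / v * (2 * ((1 - G.γ) * (V (k + 1) - V k))) :=
          mul_le_mul_of_nonneg_left h4 (by positivity)
      _ = _ := by ring
  have hmono : Monotone V := by
    refine monotone_nat_of_le_succ fun k => ?_
    have h := (hJ0 k i s).trans (hinc k i s)
    have := nonneg_of_mul_nonneg_right h (by positivity)
    linarith
  have hbdd : BddAbove (Set.range V) :=
    ⟨φmax / (1 - G.γ), by rintro _ ⟨k, rfl⟩; exact (G.stageValueInit_mem_Icc (π k) hφ_mem).2⟩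
  have hlim := tendsto_atTop_ciSup hmono hbdd
  have hdiff : Tendsto (fun k => 2 * (2 * κ / v * (1 - G.γ) * (V (k + 1) - V k))) atTop (𝓝 0) := by
    have := (((hlim.comp (tendsto_add_atTop_nat 1)).sub hlim).const_mul
      (2 * κ / v * (1 - G.γ))).const_mul 2
    simpa using this
  have hsqrt := (Real.continuous_sqrt.tendsto 0).comp hdiff
  rw [Real.sqrt_zero] at hsqrt
  refine squeeze_zero_norm (fun k => ?_) hsqrt
  refine Real.le_sqrt_of_sq_le ?_
  have h1 := sq_sum_abs_sub_le_jeffreys (hpos k i s) (hpos (k + 1) i s) (π k i s).2.2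
    (π (k + 1) i s).2.2
  have h2 : |(π (k + 1) i s).1 b - (π k i s).1 b| ≤
      ∑ b, |(π (k + 1) i s).1 b - (π k i s).1 b| :=
    Finset.single_le_sum (f := fun b => |(π (k + 1) i s).1 b - (π k i s).1 b|)
      (fun b _ => abs_nonneg _) (Finset.mem_univ b)
  have h3 := hinc k i s
  calc ‖(π (k + 1) i s).1 b - (π k i s).1 b‖ ^ 2
      ≤ (∑ b, |(π (k + 1) i s).1 b - (π k i s).1 b|) ^ 2 :=
        pow_le_pow_left₀ (norm_nonneg _) h2 2
    _ ≤ _ := h1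
    _ ≤ _ := mul_le_mul_of_nonneg_left h3 zero_le_two

/-- The sets of best actions are eventually constant, and from then on their masses increase. -/
theorem IsNPG.minBestMass_pos [∀ i, Nonempty (A i)] {η : ℝ} (h : G.IsNPG η π) (hη : 0 ≤ η)
    (hn : 0 < n) (hpos : ∀ k i s a, 0 < (π k i s).1 a)
    (hsub : ∀ i s b, Tendsto (fun k => (π (k + 1) i s).1 b - (π k i s).1 b) atTop (𝓝 0))
    {g : ℝ} (hg : 0 < g) {K : ℕ} (hK : ∀ k ≥ K, (g : EReal) ≤ G.subGap (π k)) :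
    0 < G.minBestMass π := by
  have := G.nonempty_state
  have : Nonempty (Fin n) := ⟨⟨0, hn⟩⟩
  have hκ : 0 ≤ η / (1 - G.γ) := div_nonneg hη (sub_nonneg.2 G.γ_lt_one.le)
  have hev : ∀ᶠ k in atTop, ∀ i s b,
      |G.margAdvantage i (π (k + 1)) s b - G.margAdvantage i (π k) s b| < g / 2 := by
    rw [eventually_all]; intro i
    rw [eventually_all]; intro s
    rw [eventually_all]; intro b
    have := (G.tendsto_margAdvantage_sub hsub i s b).eventually
      (Metric.ball_mem_nhds 0 (half_pos hg))
    simpa [Real.dist_eq] using this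
  obtain ⟨N, hN⟩ := eventually_atTop.1 hev
  set L := max N K
  set mass : ℕ → Fin n → S → ℝ := fun k i s => ∑ a ∈ G.bestActions (π k) i s, (π k i s).1 a
    with hmass
  have hstep : ∀ k ≥ L, ∀ i s, mass k i s ≤ mass (k + 1) i s := by
    intro k hk i s
    have hkK : K ≤ k := (le_max_right _ _).trans hk
    simp only [hmass]
    rw [bestActions_eq_of_close (hK k hkK) (hK (k + 1) (hkK.trans k.le_succ)) i s
      (hN k ((le_max_left _ _).trans hk) i s), h.eq_mulWeights k i s]
    exact Finset.sum_le_sum fun a ha =>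
      le_mulWeights_of_forall_le hκ (hpos k i s) (π k i s).2.2 (mem_bestActions.1 ha)
  have hge : ∀ k ≥ L, ∀ i s, mass L i s ≤ mass k i s := by
    intro k hk i s
    induction k, hk using Nat.le_induction with
    | base => exact le_rfl
    | succ k hk ih => exact ih.trans (hstep k hk i s)
  obtain ⟨⟨k₀, i₀, s₀⟩, -, hmin⟩ := Finset.exists_min_image
    (Finset.range (L + 1) ×ˢ (Finset.univ : Finset (Fin n × S))) (fun x => mass x.1 x.2.1 x.2.2)
    (by simp)
  have hlow : ∀ k i s, mass k₀ i₀ s₀ ≤ mass k i s := by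
    intro k i s
    rcases le_total k L with hk | hk
    · exact hmin (k, i, s) (by simp; omega)
    · exact (hmin (L, i, s) (by simp)).trans (hge k hk i s)
  have h0 : 0 < mass k₀ i₀ s₀ :=
    Finset.sum_pos (fun a _ => hpos k₀ i₀ s₀ a) (G.bestActions_nonempty _ _ _)
  exact h0.trans_le (le_ciInf fun k => le_ciInf fun i => le_ciInf fun s => hlow k i s)

/-! ### The NE-gap and its average -/

omit [∀ i, DecidableEq (A i)] in
theorem neGap_le [∀ i, Nonempty (A i)] (hn : 0 < n) {p : JointPolicy S A} {C : ℝ}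
    (h : ∀ i π', G.valueInit i (p.deviate i π') - G.valueInit i p ≤ C) : G.neGap p ≤ C := by
  have : Nonempty (Σ i : Fin n, S → stdSimplex ℝ (A i)) := ⟨⟨⟨0, hn⟩, p _⟩⟩
  exact ciSup_le fun x => h x.1 x.2

theorem IsPotential.neGap_le_div [∀ i, Nonempty (A i)] (hφ : G.IsPotential φ) (hn : 0 < n)
    (hφ_mem : ∀ s a, 0 ≤ φ s a ∧ φ s a ≤ φmax) (p : JointPolicy S A) :
    G.neGap p ≤ φmax / (1 - G.γ) := by
  refine neGap_le hn fun i π' => le_trans (le_of_eq (hφ.stageValueInit_deviate_sub p i π')) ?_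
  linarith [(G.stageValueInit_mem_Icc (p.deviate i π') hφ_mem).2,
    (G.stageValueInit_mem_Icc p hφ_mem).1]

/-- The gain of one update in terms of the suboptimality gap. -/
theorem IsNPG.margAdvantage_le [∀ i, Nonempty (A i)] {η : ℝ} (h : G.IsNPG η π) (hη : 0 < η)
    (hpos : ∀ k i s a, 0 < (π k i s).1 a) (hc : 0 < G.minBestMass π) {g : ℝ} (hg : 0 < g) {k : ℕ}
    (hk : (g : EReal) ≤ G.subGap (π k)) (i : Fin n) (s : S) (b : A i) :
    G.margAdvantage i (π k) s b ≤ (1 + 1 / (G.minBestMass π * (η / (1 - G.γ) * g))) *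
      ∑ b', (π (k + 1) i s).1 b' * G.margAdvantage i (π k) s b' := by
  obtain ⟨a, ha⟩ := G.bestActions_nonempty (π k) i s
  refine (mem_bestActions.1 ha b).trans ?_
  rw [h.eq_mulWeights]
  exact le_mul_sum_mulWeights (T := G.bestActions (π k) i s)
    (div_pos hη (sub_pos.2 G.γ_lt_one)) (hpos k i s) (π k i s).2.2
    (G.sum_mul_stageMargAdvantage (π k) (G.r i) i s)
    (fun a' ha' => (mem_bestActions.1 ha a').antisymm (mem_bestActions.1 ha' a))
    (mem_bestActions.1 ha) hg (fun b hb => add_le_of_le_subGap hk ha hb) hc (minBestMass_le k i s)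

end StochasticGame

/-- Summation of a bound by `D` that improves to a telescoping one from the index `N` on. -/
theorem sum_range_le_of_le_sub {f V : ℕ → ℝ} {D C E : ℝ} {N : ℕ} (hD : 0 ≤ D) (hC : 0 ≤ C)
    (h0 : ∀ k, f k ≤ D) (h1 : ∀ k ≥ N, f k ≤ C * (V (k + 1) - V k))
    (hV : ∀ k l, V k - V l ≤ E) (K : ℕ) :
    ∑ k ∈ Finset.range K, f k ≤ N * D + C * E := by
  have hE : 0 ≤ E := by simpa using hV 0 0
  have hle : ∀ m : ℕ, ∑ k ∈ Finset.range m, f k ≤ m * D := by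
    intro m
    refine (Finset.sum_le_sum fun k _ => h0 k).trans (le_of_eq ?_)
    simp
  rcases le_total K N with hK | hK
  · have h2 : (K : ℝ) * D ≤ N * D := mul_le_mul_of_nonneg_right (Nat.cast_le.2 hK) hD
    linarith [hle K, mul_nonneg hC hE]
  · obtain ⟨m, rfl⟩ := Nat.exists_eq_add_of_le hK
    rw [Finset.sum_range_add]
    refine add_le_add (hle N) ?_
    calc ∑ x ∈ Finset.range m, f (N + x)
        ≤ ∑ x ∈ Finset.range m, C * (V (N + (x + 1)) - V (N + x)) :=
          Finset.sum_le_sum fun x _ => h1 (N + x) (Nat.le_add_right _ _)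
      _ = C * (V (N + m) - V (N + 0)) := by
          rw [← Finset.mul_sum, Finset.sum_range_sub (fun x => V (N + x))]
      _ ≤ C * E := mul_le_mul_of_nonneg_left (hV _ _) hC

theorem corollary1 {n : ℕ} (hn : 0 < n) {S : Type*} [Fintype S] [DecidableEq S]
    {A : Fin n → Type*} [∀ i, Fintype (A i)] [∀ i, DecidableEq (A i)] [∀ i, Nonempty (A i)]
    (G : StochasticGame n S A)
    -- the game is a Markov potential game with a potential bounded by `φmax`
    (φ : S → (∀ i, A i) → ℝ) (hφ : G.IsPotential φ)
    (φmax : ℝ) (hφmax : 0 < φmax) (hφ_mem : ∀ s a, 0 ≤ φ s a ∧ φ s a ≤ φmax)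
    -- all states are visited, uniformly over the policies
    (hexp : 0 < ⨅ (π : JointPolicy S A) (s : S), G.visitation π s)
    -- independent NPG from a softmax policy, with the prescribed step size
    (π : ℕ → JointPolicy S A) (θ : ∀ i : Fin n, S → A i → ℝ)
    (hinit : π 0 = JointPolicy.softmax θ)
    (hnpg : G.IsNPG ((1 - G.γ) ^ 2 / (2 * √(n : ℝ) * φmax)) π)
    -- the suboptimality gap converges to a positive limit
    (δ : ℝ) (hδ : 0 < δ)
    (hlim : Tendsto (fun k => G.subGap (π k)) atTop (𝓝 (δ : EReal))) :
    0 < G.minBestMass π ∧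
    (∃ K' : ℕ, ∀ k ≥ K', ((δ / 2 : ℝ) : EReal) ≤ G.subGap (π k)) ∧
    ∀ K' : ℕ, (∀ k ≥ K', ((δ / 2 : ℝ) : EReal) ≤ G.subGap (π k)) →
      (∀ K : ℕ, 1 ≤ K →
        (1 / (K : ℝ)) * ∑ k ∈ Finset.range K, G.neGap (π k) ≤
          2 * G.mismatch * φmax / ((K : ℝ) * (1 - G.γ)) *
            (1 + 4 * √(n : ℝ) * φmax / (G.minBestMass π * δ * (1 - G.γ)) +
              (K' : ℝ) / (2 * G.mismatch))) ∧
      (∀ ε : ℝ, 0 < ε → ∀ K : ℕ, 1 ≤ K →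
        (2 * G.mismatch * φmax / (1 - G.γ) *
            (1 + 4 * √(n : ℝ) * φmax / (G.minBestMass π * δ * (1 - G.γ)) +
              (K' : ℝ) / (2 * G.mismatch))) / ε ≤ (K : ℝ) →
        (1 / (K : ℝ)) * ∑ k ∈ Finset.range K, G.neGap (π k) ≤ ε) := by
  have hγ : 0 < 1 - G.γ := sub_pos.2 G.γ_lt_one
  have hn' : 0 < √(n : ℝ) := Real.sqrt_pos.2 (Nat.cast_pos.2 hn)
  set η := (1 - G.γ) ^ 2 / (2 * √(n : ℝ) * φmax) with hη
  have hη0 : 0 < η := by positivity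
  have hκ : η / (1 - G.γ) = (1 - G.γ) / (2 * √(n : ℝ) * φmax) := by
    rw [hη]; field_simp
  have hpos : ∀ k i s a, 0 < (π k i s).1 a := hnpg.pos fun i s a => by
    rw [hinit]
    exact div_pos (Real.exp_pos _)
      (Finset.sum_pos (fun b _ => Real.exp_pos _) Finset.univ_nonempty)
  have hJ : ∀ k i s, jeffreys (π k i s).1 (π (k + 1) i s).1 =
      (1 - G.γ) / (2 * √(n : ℝ) * φmax) *
        ∑ b, (π (k + 1) i s).1 b * G.margAdvantage i (π k) s b := fun k i s => by
    rw [← hκ, hnpg.jeffreys_eq (hpos 0)]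
  have hgap : ∃ K' : ℕ, ∀ k ≥ K', ((δ / 2 : ℝ) : EReal) ≤ G.subGap (π k) := by
    have h1 : ((δ / 2 : ℝ) : EReal) < (δ : EReal) := EReal.coe_lt_coe_iff.2 (half_lt_self hδ)
    obtain ⟨N, hN⟩ := eventually_atTop.1 (hlim.eventually (lt_mem_nhds h1))
    exact ⟨N, fun k hk => (hN k hk).le⟩
  have hc : 0 < G.minBestMass π := by
    obtain ⟨N, hN⟩ := hgap
    exact hnpg.minBestMass_pos hη0.le hn hpos
      (StochasticGame.tendsto_iterate_sub hn hφ hφmax hφ_mem hexp hpos hJ) (half_pos hδ) hN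
  have hvis : ∀ (p : JointPolicy S A) s, 0 < G.visitation p s := fun p s =>
    hexp.trans_le (G.iInf_visitation_le p s)
  have hM : ∀ p s, 1 ≤ G.mismatch * G.visitation p s := fun p s =>
    (div_le_iff₀ (hvis p s)).1 (StochasticGame.one_div_visitation_le_mismatch hexp p s)
  obtain ⟨s₀⟩ := G.nonempty_state
  have hM0 : 0 < G.mismatch := pos_of_mul_pos_left (zero_lt_one.trans_le (hM (π 0) s₀))
    (hvis _ s₀).le
  refine ⟨hc, hgap, fun K' hK' => ?_⟩
  set M := G.mismatch
  set c := G.minBestMass π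
  set C := 1 + 4 * √(n : ℝ) * φmax / (c * δ * (1 - G.γ)) with hC
  have hC0 : 0 ≤ C := by positivity
  have hCeq : 1 + 1 / (c * (η / (1 - G.γ) * (δ / 2))) = C := by
    rw [hC, hκ]; field_simp; ring
  have hsum : ∀ K : ℕ, ∑ k ∈ Finset.range K, G.neGap (π k) ≤
      K' * (φmax / (1 - G.γ)) + 2 * M * C * (φmax / (1 - G.γ)) := by
    refine sum_range_le_of_le_sub (V := fun k => G.stageValueInit (π k) φ) (by positivity)
      (by positivity) (fun k => hφ.neGap_le_div hn hφ_mem (π k)) (fun k hk => ?_) fun k l => ?_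
    · refine StochasticGame.neGap_le hn fun i π' => ?_
      refine StochasticGame.valueInit_deviate_sub_le hn hφmax hφ_mem hφ hvis (hpos k) (hpos (k + 1))
        (hJ k) (hM _) hM0.le hC0 (fun i s b => ?_) i π'
      rw [← hCeq]
      exact hnpg.margAdvantage_le hη0 hpos hc (half_pos hδ) (hK' k hk) i s b
    · linarith [(G.stageValueInit_mem_Icc (π k) hφ_mem).2,
        (G.stageValueInit_mem_Icc (π l) hφ_mem).1]
  have havg : ∀ K : ℕ, 1 ≤ K → (1 / (K : ℝ)) * ∑ k ∈ Finset.range K, G.neGap (π k) ≤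
      2 * M * φmax / ((K : ℝ) * (1 - G.γ)) * (C + (K' : ℝ) / (2 * M)) := by
    intro K hK
    have hK0 : (0 : ℝ) < K := Nat.cast_pos.2 hK
    refine (mul_le_mul_of_nonneg_left (hsum K) (by positivity)).trans (le_of_eq ?_)
    field_simp
    ring
  refine ⟨havg, fun ε hε K hK hKε => (havg K hK).trans ?_⟩
  have hK0 : (0 : ℝ) < K := Nat.cast_pos.2 hK
  rw [div_le_iff₀ hε] at hKε
  calc 2 * M * φmax / ((K : ℝ) * (1 - G.γ)) * (C + (K' : ℝ) / (2 * M))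
      = (2 * M * φmax / (1 - G.γ) * (C + (K' : ℝ) / (2 * M))) / K := by field_simp
    _ ≤ ε := by
      rw [div_le_iff₀ hK0, mul_comm ε]
      exact hKε
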